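/- Let $\mathbb K$ be a field and let $\mathcal C$ be an ordered Grothendieck category over $\mathbb K$, i.e. a $\mathbb K$-linear Grothendieck category together with a partially ordered set $(I,\le)$ in which every down-set $\{j\in I : j\le i\}$ is finite, objects $X_i$ ($i\in I$) of $\mathcal C$, and for each $i\in I$ a finite set $\Theta_i$ of morphisms from $X_i$ to various objects $X_j$ with $j<i$, such that, with $Y_i:=\bigcap_{f\in\Theta_i}\ker f\subseteq X_i$: 1. every object of $\mathcal C$ is the sum of its subobjects that are isomorphic to subquotients of finite direct sums of objects $X_i$ (repetitions allowed); 2. $Y_i$ has finite length and is the socle of $X_i$; write $Y_i\cong\bigoplus_{S\in\mathcal S_i}S^{\oplus p(S)}$, where $\mathcal S_i$ is the (finite) set of isomorphism classes of simple direct summands of $Y_i$ and $p(S)\ge 1$ is the multiplicity of $S$; 3. the sets $\mathcal S_i$, $i\in I$, are pairwise disjoint; 4. $X_i\cong\bigoplus_{S\in\mathcal S_i}\widetilde S^{\oplus p(S)}$ for objects $\widetilde S$ with socle isomorphic to $S$. Let $\mathcal C_{\mathrm{fin}}$ be the thick abelian subcategory generated by the $X_i$, i.e. the smallest full subcategory of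 $\mathcal C$ that contains $0$ and all $X_i$ and is closed under subobjects, quotients and extensions. For a $\mathbb K$-coalgebra $C$ let $\mathcal M^C$ be the category of right $C$-comodules. Call $C$ left semiperfect if every indecomposable injective right $C$-comodule is finite dimensional. **Theorem.** Suppose that $\operatorname{End}_{\mathcal C}(S)$ is finite dimensional over $\mathbb K$ for every simple object $S$ of $\mathcal C$. Then there are a $\mathbb K$-coalgebra $C$ and an equivalence $\mathcal C\simeq\mathcal M^C$ of $\mathbb K$-linear categories. Moreover, any coalgebra $C$ for which such an equivalence exists is left semiperfect, and any $\mathbb K$-linear equivalence $F:\mathcal C\to\mathcal M^C$ identifies $\mathcal C_{\mathrm{fin}}$ with the category of finite-dimensional right $C$-comodules: an object $M$ of $\mathcal C$ lies in $\mathcal C_{\mathrm{fin}}$ if and only if $F(M)$ is finite dimensional. -/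

import Mathlib

open CategoryTheory CategoryTheory.Limits
open scoped TensorProduct

universe w v u

/- Right comodules over a coalgebra -/

/-- A right `C`-comodule structure on a `K`-vector space `M`: a coassociative and counital
coaction `M → M ⊗ C`. -/
class RightComodule (K : Type*) [Field K] (C : Type*) [AddCommGroup C] [Module K C]
    [Coalgebra K C] (M : Type*) [AddCommGroup M] [Module K M] where
  /-- The coaction. -/
  coact : M →ₗ[K] M ⊗[K] C
  /-- `(ρ ⊗ id) ρ = (id ⊗ Δ) ρ`. -/
  coassoc : (TensorProduct.assoc K M C C).toLinearMap ∘ₗ coact.rTensor C ∘ₗ coact =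
    (Coalgebra.comul (R := K) (A := C)).lTensor M ∘ₗ coact
  /-- `(id ⊗ ε) ρ = id`. -/
  counit : (TensorProduct.rid K M).toLinearMap ∘ₗ
    (Coalgebra.counit (R := K) (A := C)).lTensor M ∘ₗ coact = LinearMap.id

/-- The type of right comodules over the `K`-coalgebra `C`. -/
structure ComodCat (K : Type*) [Field K] (C : Type*) [AddCommGroup C] [Module K C]
    [Coalgebra K C] where
  /-- The underlying vector space. -/
  carrier : Type w
  [addCommGroup : AddCommGroup carrier]
  [module : Module K carrier]
  [comodule : RightComodule K C carrier]

namespace ComodCat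

attribute [instance] ComodCat.addCommGroup ComodCat.module ComodCat.comodule

section

variable {K : Type*} [Field K] {C : Type*} [AddCommGroup C] [Module K C] [Coalgebra K C]

instance : CoeSort (ComodCat.{w} K C) (Type w) := ⟨ComodCat.carrier⟩

/-- The coaction of a right comodule. -/
def ρ (M : ComodCat.{w} K C) : M →ₗ[K] M ⊗[K] C := RightComodule.coact

/-- Morphisms of right comodules: linear maps that commute with the coactions. -/
@[ext]
structure Hom (M N : ComodCat.{w} K C) where
  /-- The underlying linear map. -/
  lin : M →ₗ[K] N
  comm : N.ρ ∘ₗ lin = lin.rTensor C ∘ₗ M.ρ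

instance : Category (ComodCat.{w} K C) where
  Hom M N := Hom M N
  id M := ⟨LinearMap.id, by simp⟩
  comp f g := ⟨g.lin ∘ₗ f.lin, by
    rw [← LinearMap.comp_assoc, g.comm, LinearMap.comp_assoc, f.comm, LinearMap.rTensor_comp,
      LinearMap.comp_assoc]⟩

@[ext]
theorem hom_ext {M N : ComodCat.{w} K C} {f g : M ⟶ N} (h : f.lin = g.lin) : f = g :=
  Hom.ext h

@[simp] theorem id_lin (M : ComodCat.{w} K C) : Hom.lin (𝟙 M) = LinearMap.id := rfl

@[simp] theorem comp_lin {M N P : ComodCat.{w} K C} (f : M ⟶ N) (g : N ⟶ P) :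
    (f ≫ g).lin = g.lin ∘ₗ f.lin := rfl

section

variable {M N : ComodCat.{w} K C}

instance : Zero (M ⟶ N) := ⟨⟨0, by simp⟩⟩
instance : Add (M ⟶ N) := ⟨fun f g => ⟨f.lin + g.lin, by
  rw [LinearMap.comp_add, f.comm, g.comm, LinearMap.rTensor_add, LinearMap.add_comp]⟩⟩
instance : Neg (M ⟶ N) := ⟨fun f => ⟨-f.lin, by
  rw [LinearMap.comp_neg, f.comm, LinearMap.rTensor_neg, LinearMap.neg_comp]⟩⟩
instance : SMul K (M ⟶ N) := ⟨fun r f => ⟨r • f.lin, by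
  rw [LinearMap.comp_smul, f.comm, LinearMap.rTensor_smul, LinearMap.smul_comp]⟩⟩

@[simp] theorem zero_lin : Hom.lin (0 : M ⟶ N) = 0 := rfl
@[simp] theorem add_lin (f g : M ⟶ N) : Hom.lin (f + g) = f.lin + g.lin := rfl
@[simp] theorem neg_lin (f : M ⟶ N) : Hom.lin (-f) = -f.lin := rfl
@[simp] theorem smul_lin (r : K) (f : M ⟶ N) : Hom.lin (r • f) = r • f.lin := rfl

instance : AddCommGroup (M ⟶ N) where
  add_assoc f g h := hom_ext (add_assoc f.lin g.lin h.lin)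
  zero_add f := hom_ext (zero_add f.lin)
  add_zero f := hom_ext (add_zero f.lin)
  neg_add_cancel f := hom_ext (neg_add_cancel f.lin)
  add_comm f g := hom_ext (add_comm f.lin g.lin)
  nsmul := nsmulRec
  zsmul := zsmulRec

instance : Module K (M ⟶ N) where
  one_smul f := hom_ext (one_smul K f.lin)
  mul_smul r s f := hom_ext (mul_smul r s f.lin)
  smul_zero r := hom_ext (smul_zero r)
  smul_add r f g := hom_ext (smul_add r f.lin g.lin)
  add_smul r s f := hom_ext (add_smul r s f.lin)
  zero_smul f := hom_ext (zero_smul K f.lin)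

end

instance : Preadditive (ComodCat.{w} K C) where
  add_comp _ _ _ f f' g := hom_ext (LinearMap.comp_add f.lin f'.lin g.lin)
  comp_add _ _ _ f g g' := hom_ext (by
    simp only [comp_lin, add_lin, LinearMap.add_comp])

instance : Linear K (ComodCat.{w} K C) where
  homModule _ _ := inferInstance
  smul_comp _ _ _ r f g := hom_ext (by
    simp only [comp_lin, smul_lin, LinearMap.comp_smul])
  comp_smul _ _ _ f r g := hom_ext (by
    simp only [comp_lin, smul_lin, LinearMap.smul_comp])

theorem ρ_coassoc (M : ComodCat.{w} K C) (m : M) :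
    TensorProduct.assoc K M C C (M.ρ.rTensor C (M.ρ m)) =
      (Coalgebra.comul (R := K) (A := C)).lTensor M (M.ρ m) :=
  LinearMap.congr_fun RightComodule.coassoc m

theorem ρ_counit (M : ComodCat.{w} K C) (m : M) :
    TensorProduct.rid K M ((Coalgebra.counit (R := K) (A := C)).lTensor M (M.ρ m)) = m :=
  LinearMap.congr_fun RightComodule.counit m

/-- The coaction on the direct sum of two comodules. -/
def prodCoact (M N : ComodCat.{w} K C) : (M × N) →ₗ[K] (M × N) ⊗[K] C :=
  LinearMap.coprod ((LinearMap.inl K M N).rTensor C ∘ₗ M.ρ)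
    ((LinearMap.inr K M N).rTensor C ∘ₗ N.ρ)

theorem assoc_rTensor_rTensor {K C V W : Type*} [Field K] [AddCommGroup C] [Module K C]
    [AddCommGroup V] [Module K V] [AddCommGroup W] [Module K W] (f : V →ₗ[K] W) (x : (V ⊗[K] C) ⊗[K] C) :
    TensorProduct.assoc K W C C ((f.rTensor C).rTensor C x) =
      f.rTensor (C ⊗[K] C) (TensorProduct.assoc K V C C x) := by
  refine LinearMap.congr_fun (f := (TensorProduct.assoc K W C C).toLinearMap ∘ₗ
    (f.rTensor C).rTensor C) (g := f.rTensor (C ⊗[K] C) ∘ₗ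
    (TensorProduct.assoc K V C C).toLinearMap) ?_ x
  ext; simp

theorem rid_rTensor {K V W : Type*} [Field K] [AddCommGroup V] [Module K V] [AddCommGroup W]
    [Module K W] (f : V →ₗ[K] W) (x : V ⊗[K] K) :
    TensorProduct.rid K W (f.rTensor K x) = f (TensorProduct.rid K V x) := by
  refine LinearMap.congr_fun (f := (TensorProduct.rid K W).toLinearMap ∘ₗ f.rTensor K)
    (g := f ∘ₗ (TensorProduct.rid K V).toLinearMap) ?_ x
  ext; simp

theorem lTensor_rTensor {K C V W D : Type*} [Field K] [AddCommGroup C] [Module K C]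
    [AddCommGroup V] [Module K V] [AddCommGroup W] [Module K W] [AddCommGroup D] [Module K D] (f : V →ₗ[K] W) (g : C →ₗ[K] D) (x : V ⊗[K] C) :
    g.lTensor W (f.rTensor C x) = f.rTensor D (g.lTensor V x) := by
  rw [← LinearMap.comp_apply, ← LinearMap.comp_apply, LinearMap.lTensor_comp_rTensor,
    LinearMap.rTensor_comp_lTensor]

theorem prodCoact_comp_inl (M N : ComodCat.{w} K C) :
    prodCoact M N ∘ₗ LinearMap.inl K M N = (LinearMap.inl K M N).rTensor C ∘ₗ M.ρ :=
  LinearMap.coprod_inl _ _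

theorem prodCoact_comp_inr (M N : ComodCat.{w} K C) :
    prodCoact M N ∘ₗ LinearMap.inr K M N = (LinearMap.inr K M N).rTensor C ∘ₗ N.ρ :=
  LinearMap.coprod_inr _ _

theorem fst_comm (M N : ComodCat.{w} K C) :
    M.ρ ∘ₗ LinearMap.fst K M N = (LinearMap.fst K M N).rTensor C ∘ₗ prodCoact M N := by
  refine LinearMap.prod_ext ?_ ?_
  · rw [LinearMap.comp_assoc, LinearMap.comp_assoc, prodCoact_comp_inl,
      LinearMap.fst_comp_inl, ← LinearMap.comp_assoc, ← LinearMap.rTensor_comp,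
      LinearMap.fst_comp_inl, LinearMap.rTensor_id,
      LinearMap.comp_id, LinearMap.id_comp]
  · rw [LinearMap.comp_assoc, LinearMap.comp_assoc, prodCoact_comp_inr,
      LinearMap.fst_comp_inr, ← LinearMap.comp_assoc, ← LinearMap.rTensor_comp,
      LinearMap.fst_comp_inr, LinearMap.rTensor_zero,
      LinearMap.comp_zero, LinearMap.zero_comp]

theorem snd_comm (M N : ComodCat.{w} K C) :
    N.ρ ∘ₗ LinearMap.snd K M N = (LinearMap.snd K M N).rTensor C ∘ₗ prodCoact M N := by
  refine LinearMap.prod_ext ?_ ?_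
  · rw [LinearMap.comp_assoc, LinearMap.comp_assoc, prodCoact_comp_inl,
      LinearMap.snd_comp_inl, ← LinearMap.comp_assoc, ← LinearMap.rTensor_comp,
      LinearMap.snd_comp_inl, LinearMap.rTensor_zero,
      LinearMap.comp_zero, LinearMap.zero_comp]
  · rw [LinearMap.comp_assoc, LinearMap.comp_assoc, prodCoact_comp_inr,
      LinearMap.snd_comp_inr, ← LinearMap.comp_assoc, ← LinearMap.rTensor_comp,
      LinearMap.snd_comp_inr, LinearMap.rTensor_id,
      LinearMap.comp_id, LinearMap.id_comp]

theorem coassoc_aux {V : Type*} [AddCommGroup V] [Module K V] (σ : V →ₗ[K] V ⊗[K] C)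
    (M : ComodCat.{w} K C) (i : M →ₗ[K] V) (h : σ ∘ₗ i = i.rTensor C ∘ₗ M.ρ) (m : M) :
    TensorProduct.assoc K V C C (σ.rTensor C (σ (i m))) =
      (Coalgebra.comul (R := K) (A := C)).lTensor V (σ (i m)) := by
  have h1 : σ (i m) = i.rTensor C (M.ρ m) := LinearMap.congr_fun h m
  rw [h1, ← LinearMap.comp_apply, ← LinearMap.rTensor_comp, h, LinearMap.rTensor_comp,
    LinearMap.comp_apply, assoc_rTensor_rTensor, ρ_coassoc, lTensor_rTensor]

theorem counit_aux {V : Type*} [AddCommGroup V] [Module K V] (σ : V →ₗ[K] V ⊗[K] C)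
    (M : ComodCat.{w} K C) (i : M →ₗ[K] V) (h : σ ∘ₗ i = i.rTensor C ∘ₗ M.ρ) (m : M) :
    TensorProduct.rid K V ((Coalgebra.counit (R := K) (A := C)).lTensor V (σ (i m))) = i m := by
  have h1 : σ (i m) = i.rTensor C (M.ρ m) := LinearMap.congr_fun h m
  rw [h1, lTensor_rTensor, rid_rTensor, ρ_counit]

/-- The direct sum of two comodules. -/
def prod (M N : ComodCat.{w} K C) : ComodCat.{w} K C where
  carrier := M × N
  comodule :=
    { coact := prodCoact M N
      coassoc := LinearMap.prod_ext
        (LinearMap.ext fun m => coassoc_aux _ M _ (prodCoact_comp_inl M N) m)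
        (LinearMap.ext fun n => coassoc_aux _ N _ (prodCoact_comp_inr M N) n)
      counit := LinearMap.prod_ext
        (LinearMap.ext fun m => counit_aux _ M _ (prodCoact_comp_inl M N) m)
        (LinearMap.ext fun n => counit_aux _ N _ (prodCoact_comp_inr M N) n) }

/-- The direct sum of two comodules with its inclusions and projections. -/
def prodBicone (M N : ComodCat.{w} K C) : BinaryBicone M N where
  pt := prod M N
  inl := ⟨LinearMap.inl K M N, prodCoact_comp_inl M N⟩
  inr := ⟨LinearMap.inr K M N, prodCoact_comp_inr M N⟩
  fst := ⟨LinearMap.fst K M N, fst_comm M N⟩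
  snd := ⟨LinearMap.snd K M N, snd_comm M N⟩
  inl_fst := hom_ext (LinearMap.fst_comp_inl K M N)
  inl_snd := hom_ext ((LinearMap.snd_comp_inl K M N).trans (zero_lin (M := M) (N := N)).symm)
  inr_fst := hom_ext ((LinearMap.fst_comp_inr K M N).trans (zero_lin (M := N) (N := M)).symm)
  inr_snd := hom_ext (LinearMap.snd_comp_inr K M N)

instance : HasBinaryBiproducts (ComodCat.{w} K C) where
  has_binary_biproduct M N := hasBinaryBiproduct_of_total (prodBicone M N) <| hom_ext <| by
    refine LinearMap.ext fun x => ?_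
    exact Prod.ext (add_zero x.1) (zero_add x.2)

end

end ComodCat

/-- A coalgebra is left semiperfect if every indecomposable injective right comodule is finite
dimensional. -/
def LeftSemiperfect (K : Type v) [Field K] (C : Type v) [AddCommGroup C] [Module K C]
    [Coalgebra K C] : Prop :=
  ∀ M : ComodCat.{v} K C, Injective M → Indecomposable M → FiniteDimensional K M

/- Ordered Grothendieck categories -/

section

attribute [local instance] CategoryTheory.Abelian.hasFiniteBiproducts

namespace OrderedGrothendieck

variable {𝒞 : Type u} [Category.{v} 𝒞]

/-- An object has finite length if it is both Noetherian and Artinian. -/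
def HasFiniteLength (M : 𝒞) : Prop := IsNoetherianObject M ∧ IsArtinianObject M

variable [Abelian 𝒞]

/-- `N` is a subobject of a quotient of `M`. -/
def IsSubquotient (N M : 𝒞) : Prop :=
  ∃ (Z : 𝒞) (π : M ⟶ Z) (j : N ⟶ Z), Epi π ∧ Mono j

/-- `Y` is the socle of `M`: the sum of all the simple subobjects of `M`. -/
def IsSocle {M : 𝒞} (Y : Subobject M) : Prop :=
  IsLUB {S : Subobject M | Simple (S : 𝒞)} Y

/-- `S` is a simple direct summand of `Y`. -/
def IsSimpleSummand (S Y : 𝒞) : Prop := Simple S ∧ Nonempty (Retract S Y)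

/-- `N` is a subquotient of a finite direct sum of objects of the family `X`
(repetitions are allowed). -/
def IsSubquotientOfSum {I : Type w} (X : I → 𝒞) (N : 𝒞) : Prop :=
  ∃ (n : ℕ) (a : Fin n → I), IsSubquotient N (⨁ fun k => X (a k))

/-- The intersection of the kernels of a finite set of morphisms out of `X i`. -/
noncomputable def interKer {I : Type w} [LT I] (X : I → 𝒞) {i : I}
    (Θ : Finset (Σ j : {j : I // j < i}, (X i ⟶ X j))) : Subobject (X i) :=
  Θ.inf fun f => kernelSubobject f.2

end OrderedGrothendieck

open OrderedGrothendieck in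
/-- The data and the axioms that make a Grothendieck category `𝒞` an ordered Grothendieck
category with index poset `I`. -/
structure OrderedGrothendieckStructure (𝒞 : Type u) [Category.{v} 𝒞] [Abelian 𝒞]
    (I : Type w) [PartialOrder I] where
  /-- Every element of `I` dominates only finitely many elements. -/
  finite_downset : ∀ i : I, (Set.Iic i).Finite
  /-- The objects `X i`. -/
  X : I → 𝒞
  /-- A finite set of morphisms from `X i` to various `X j` with `j < i`. -/
  Θ : ∀ i : I, Finset (Σ j : {j : I // j < i}, (X i ⟶ X j))
  /-- Every object is the sum of its subobjects that are subquotients of finite direct sums of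
  the objects `X i`. -/
  generates : ∀ M : 𝒞, IsLUB {N : Subobject M | IsSubquotientOfSum X (N : 𝒞)} ⊤
  /-- `Y i`, the intersection of the kernels of the morphisms in `Θ i`, has finite length. -/
  finiteLength : ∀ i, HasFiniteLength (interKer X (Θ i) : 𝒞)
  /-- `Y i` is the socle of `X i`. -/
  socle : ∀ i, IsSocle (interKer X (Θ i))
  /-- No simple object is a direct summand of both `Y i` and `Y j` for `i ≠ j`. -/
  disjoint : ∀ i j, i ≠ j → ∀ S : 𝒞,
    IsSimpleSummand S (interKer X (Θ i) : 𝒞) → ¬ IsSimpleSummand S (interKer X (Θ j) : 𝒞)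
  /-- `Y i` is the direct sum of pairwise non-isomorphic simple objects `S k` with multiplicities
  `p k`, and `X i` is the direct sum, with the same multiplicities, of objects `S' k` whose socle
  is `S k`. -/
  decomposition : ∀ i, ∃ (m : ℕ) (S S' : Fin m → 𝒞) (p : Fin m → ℕ),
    (∀ k, Simple (S k)) ∧ (∀ k l, Nonempty (S k ≅ S l) → k = l) ∧ (∀ k, 0 < p k) ∧
    Nonempty ((interKer X (Θ i) : 𝒞) ≅ ⨁ fun q : (Σ k : Fin m, Fin (p k)) => S q.1) ∧
    (∀ k, ∃ Z : Subobject (S' k), IsSocle Z ∧ Nonempty ((Z : 𝒞) ≅ S k)) ∧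
    Nonempty (X i ≅ ⨁ fun q : (Σ k : Fin m, Fin (p k)) => S' q.1)

/-- The thick abelian subcategory of `𝒞` generated by the objects `X i`: the smallest full
subcategory that contains them and the zero object and is closed under subobjects, quotients and
extensions. -/
def OrderedGrothendieckStructure.fin {𝒞 : Type u} [Category.{v} 𝒞] [Abelian 𝒞]
    {I : Type w} [PartialOrder I] (G : OrderedGrothendieckStructure 𝒞 I) : ObjectProperty 𝒞 :=
  fun M => ∀ P : ObjectProperty 𝒞, P.IsSerreClass → (∀ i, P (G.X i)) → P M

end

/-!
The proof reconstructs the coalgebra from an injective cogenerator, in the manner of Takeuchi and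
Gabriel. The objects `X i` need not be injective when a simple object has endomorphisms other than
scalars, so they serve only to control the Serre subcategory `G.fin`.

*The Serre subcategory.* By induction along the well-founded order of `I`, the quotient `X i / Y i`
embeds in a finite sum of objects `X j` with `j < i`, and `Y i` is a finite sum of simple objects.
Hence a Serre class that contains the simple objects contains `G.fin` (`fin_le_of_simple`). Applied
to suitable Serre classes, this shows that every nonzero object has a simple subobject
(`exists_simple_mono`), and that `Hom (M, E)` is finite dimensional for `M` in `G.fin` whenever `E`
is injective with `Hom (T, E)` finite dimensional for all simple `T`. The latter holds for the
product `E` of the injective hulls of the simple objects, a cogenerator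
(`exists_injective_cogenerator`). If `E` is injective with an essential simple subobject `S`, then
all morphisms from the objects `X j` to `E` land in the image of a finite sum of copies of the one
`X i` with `S` a summand of `Y i`; so `E` belongs to `G.fin` (`fin_of_essentialMono`).

*Reconstruction.* The space `Hom (M, E)` is profinite: it is the limit of the finite dimensional
spaces `Hom (N, E)` over the subobjects `N` of `M` in `G.fin`. Its continuous dual `ω M` therefore
satisfies `Hom (ω M, K) = Hom (M, E)` (`ContDual.exists_eval_eq`), so `ω` is exact, faithful and
cocontinuous, and comonadic over vector spaces by Beck's theorem
(`ContDual.exists_isEquivalence_comparison`). The comonad is linear and every element of its value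
at `V` comes from a finite dimensional space over `V`; such a comonad is `V ↦ V ⊗ C` for a coalgebra
structure on its value `C` at `K`, and its coalgebras are the comodules over `C`
(`TensorComonad.toComodFunctor`).

*Comparison of finiteness conditions.* Let `F` be an equivalence with the comodules over `C`. The
objects with finite dimensional image form a Serre class, and simple comodules are finite
dimensional since every element of a comodule lies in a finite dimensional subcomodule
(`ComodCat.exists_finiteDimensional_subcomodule`), so this class contains `G.fin`. Conversely, if
`F M` is finite dimensional, a subobject of `M` in `G.fin` of the largest dimension is all of `M`
(`fin_iff_finiteDimensional`). An indecomposable injective comodule corresponds to an indecomposable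
injective object; this has a simple subobject, which is essential by indecomposability, so the
object belongs to `G.fin` and the comodule is finite dimensional.
-/

/-! ### Directed unions of subobjects -/

namespace GrothendieckLattice

variable {𝒞 : Type u} [Category.{v} 𝒞] [Abelian 𝒞] [IsGrothendieckAbelian.{v} 𝒞]

/-- A monotone family of subobjects, as a functor to the category of monomorphisms. -/
noncomputable def subobjectDiagram {J : Type v} [Preorder J] {M : 𝒞} (s : J →o Subobject M) :
    J ⥤ MonoOver M where
  obj j := MonoOver.mk (s j).arrow
  map f := MonoOver.homMk (Subobject.ofLE _ _ (s.monotone (leOfHom f)))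

/-- The inclusions of a monotone family of subobjects into an upper bound. -/
noncomputable def subobjectCocone {J : Type v} [Preorder J] {M : 𝒞} (s : J →o Subobject M)
    (U : Subobject M) (hU : ∀ j, s j ≤ U) : Cocone (subobjectDiagram s ⋙ MonoOver.forget M) where
  pt := Over.mk U.arrow
  ι := { app := fun j => Over.homMk (Subobject.ofLE _ _ (hU j)) (Subobject.ofLE_arrow _)
         naturality := fun i j f => by
            ext
            exact (Subobject.ofLE_comp_ofLE _ _ _ (s.monotone (leOfHom f)) (hU j)).trans
              (Category.comp_id (Subobject.ofLE _ _ (hU i))).symm }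

/-- By the exactness of filtered colimits, a directed supremum of subobjects is their colimit. -/
theorem exists_isColimit_of_isLUB {J : Type v} [Preorder J] [IsDirectedOrder J] [Nonempty J]
    {M : 𝒞} (s : J →o Subobject M) {U : Subobject M} (hU : IsLUB (Set.range s) U) :
    Nonempty (IsColimit ((Over.forget M).mapCocone
      (subobjectCocone s U fun j => hU.1 ⟨j, rfl⟩))) := by
  have : Mono (subobjectCocone s U fun j => hU.1 ⟨j, rfl⟩).pt.hom :=
    inferInstanceAs (Mono U.arrow)
  refine ⟨IsGrothendieckAbelian.isColimitMapCoconeOfSubobjectMkEqISup _ _ ?_⟩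
  have h1 : Subobject.mk (subobjectCocone s U fun j => hU.1 ⟨j, rfl⟩).pt.hom = U :=
    Subobject.mk_arrow U
  have h2 : ∀ j, Subobject.mk ((subobjectDiagram s).obj j).obj.hom = s j :=
    fun j => Subobject.mk_arrow _
  rw [h1]
  simp_rw [h2]
  exact hU.unique isLUB_iSup

/-- A directed set of subobjects is the range of a monotone family with a small index type. -/
theorem exists_small_range_eq {M : 𝒞} {D : Set (Subobject M)} (hne : D.Nonempty)
    (hD : DirectedOn (· ≤ ·) D) : ∃ (J : Type v) (_ : Preorder J) (_ : IsDirectedOrder J)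
      (_ : Nonempty J) (s : J →o Subobject M), Set.range s = D := by
  let _ : Preorder (Shrink.{v} D) := Preorder.lift (equivShrink D).symm
  refine ⟨Shrink.{v} D, inferInstance, ⟨fun i j => ?_⟩, ⟨equivShrink D ⟨_, hne.some_mem⟩⟩,
    ⟨fun j => ((equivShrink D).symm j).1, fun i j h => h⟩, ?_⟩
  · obtain ⟨z, hz, h1, h2⟩ := hD _ ((equivShrink D).symm i).2 _ ((equivShrink D).symm j).2
    refine ⟨equivShrink D ⟨z, hz⟩, ?_, ?_⟩
    · change (equivShrink D).symm i ≤ (equivShrink D).symm _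
      rw [Equiv.symm_apply_apply]; exact h1
    · change (equivShrink D).symm j ≤ (equivShrink D).symm _
      rw [Equiv.symm_apply_apply]; exact h2
  · ext N
    constructor
    · rintro ⟨j, rfl⟩
      exact ((equivShrink D).symm j).2
    · intro hN
      exact ⟨equivShrink D ⟨N, hN⟩, congrArg Subtype.val ((equivShrink D).symm_apply_apply _)⟩

attribute [local instance] IsFiltered.isConnected in
/-- A morphism out of a directed supremum is a monomorphism if its restrictions are. -/
theorem mono_of_isLUB {M Z : 𝒞} {D : Set (Subobject M)} (hne : D.Nonempty)
    (hD : DirectedOn (· ≤ ·) D) {U : Subobject M} (hU : IsLUB D U) (h : (U : 𝒞) ⟶ Z)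
    (hh : ∀ N (hN : N ∈ D), Mono (Subobject.ofLE N U (hU.1 hN) ≫ h)) : Mono h := by
  obtain ⟨J, _, _, _, s, rfl⟩ := exists_small_range_eq hne hD
  obtain ⟨hcl⟩ := exists_isColimit_of_isLUB s hU
  let α : (subobjectDiagram s ⋙ MonoOver.forget M) ⋙ Over.forget M ⟶ (Functor.const J).obj Z :=
    { app := fun j => Subobject.ofLE (s j) U (hU.1 ⟨j, rfl⟩) ≫ h
      naturality := fun i j f => by
        refine Eq.trans ?_ (Category.comp_id (Subobject.ofLE (s i) U (hU.1 ⟨i, rfl⟩) ≫ h)).symm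
        exact (Category.assoc _ _ _).symm.trans (congrArg (· ≫ h) (Subobject.ofLE_comp_ofLE _ _ _
          (s.monotone (leOfHom f)) (hU.1 ⟨j, rfl⟩))) }
  have : ∀ j, Mono (α.app j) := fun j => hh _ ⟨j, rfl⟩
  have : Mono α := NatTrans.mono_of_mono_app α
  exact colim.map_mono' α hcl (isColimitConstCocone J Z) h
    (fun j => (Category.comp_id (Subobject.ofLE (s j) U (hU.1 ⟨j, rfl⟩) ≫ h)).symm)

/-- Compatible morphisms on the members of a directed set of subobjects extend to its supremum. -/
theorem exists_glue_of_isLUB {M Z : 𝒞} {D : Set (Subobject M)} (hne : D.Nonempty)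
    (hD : DirectedOn (· ≤ ·) D) {U : Subobject M} (hU : IsLUB D U)
    (g : ∀ N : Subobject M, N ∈ D → ((N : 𝒞) ⟶ Z))
    (hg : ∀ N N' (hN : N ∈ D) (hN' : N' ∈ D) (h : N ≤ N'),
      Subobject.ofLE N N' h ≫ g N' hN' = g N hN) :
    ∃ h : (U : 𝒞) ⟶ Z, ∀ N (hN : N ∈ D), Subobject.ofLE N U (hU.1 hN) ≫ h = g N hN := by
  obtain ⟨J, _, _, _, s, rfl⟩ := exists_small_range_eq hne hD
  obtain ⟨hcl⟩ := exists_isColimit_of_isLUB s hU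
  let c' : Cocone ((subobjectDiagram s ⋙ MonoOver.forget M) ⋙ Over.forget M) :=
    { pt := Z
      ι := { app := fun j => g (s j) ⟨j, rfl⟩
             naturality := fun i j f =>
              (hg (s i) (s j) ⟨i, rfl⟩ ⟨j, rfl⟩ (s.monotone (leOfHom f))).trans
                (Category.comp_id (g (s i) ⟨i, rfl⟩)).symm } }
  refine ⟨hcl.desc c', ?_⟩
  rintro _ ⟨j, rfl⟩
  exact hcl.fac c' j

end GrothendieckLattice

/-! ### Pseudo-complements and injective hulls -/

namespace GrothendieckLattice

section

variable {𝒞 : Type u} [Category.{v} 𝒞] [Abelian 𝒞]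

theorem factors_iff_comp_cokernel {M T : 𝒞} (B : Subobject M) (f : T ⟶ M) :
    B.Factors f ↔ f ≫ cokernel.π B.arrow = 0 := by
  constructor
  · intro h
    rw [← Subobject.factorThru_arrow B f h, Category.assoc, cokernel.condition, comp_zero]
  · intro h
    rw [← Abelian.monoLift_comp B.arrow f h]
    exact Subobject.factors_comp_arrow _

theorem disjoint_iff_factors {M : 𝒞} {A B : Subobject M} :
    Disjoint A B ↔ ∀ ⦃T : 𝒞⦄ (f : T ⟶ M), A.Factors f → B.Factors f → f = 0 := by
  rw [disjoint_iff]
  constructor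
  · intro h T f hA hB
    rw [← Subobject.bot_factors_iff_zero, ← h, Subobject.inf_factors]
    exact ⟨hA, hB⟩
  · intro h
    have h1 := h (A ⊓ B).arrow (Subobject.inf_arrow_factors_left A B)
      (Subobject.inf_arrow_factors_right A B)
    rw [← Subobject.mk_arrow (A ⊓ B)]
    exact Subobject.mk_eq_bot_iff_zero.2 h1

theorem disjoint_iff_mono {M : 𝒞} {A B : Subobject M} :
    Disjoint A B ↔ Mono (A.arrow ≫ cokernel.π B.arrow) := by
  rw [disjoint_iff_factors]
  constructor
  · intro h
    refine Preadditive.mono_of_cancel_zero _ fun {T} g hg => ?_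
    rw [← cancel_mono A.arrow, zero_comp]
    refine h _ (Subobject.factors_comp_arrow g) ?_
    rwa [factors_iff_comp_cokernel, Category.assoc]
  · intro h T f hA hB
    rw [← Subobject.factorThru_arrow A f hA] at hB ⊢
    rw [factors_iff_comp_cokernel, Category.assoc] at hB
    rw [zero_of_comp_mono _ hB, zero_comp]

end

variable {𝒞 : Type u} [Category.{v} 𝒞] [Abelian 𝒞] [IsGrothendieckAbelian.{v} 𝒞]

/-- A subobject disjoint from `A` is contained in a maximal one. -/
theorem exists_maximal_disjoint {M : 𝒞} {A B₀ : Subobject M} (h : Disjoint A B₀) :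
    ∃ B, B₀ ≤ B ∧ Maximal (Disjoint A) B := by
  refine zorn_le_nonempty₀ {B | Disjoint A B} (fun c hc hchain y hy => ?_) B₀ h
  have hU := isLUB_sSup c
  refine ⟨sSup c, ?_, hU.1⟩
  refine Disjoint.symm (disjoint_iff_mono.2 ?_)
  refine mono_of_isLUB ⟨y, hy⟩ hchain.directedOn hU _ fun N hN => ?_
  rw [← Category.assoc, Subobject.ofLE_arrow]
  exact disjoint_iff_mono.1 (hc hN).symm

/-- A subobject `A` of an injective object `J` has an injective hull inside `J`: a retract `H` of
`J` in which `A` is essential. -/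
theorem exists_injectiveHull {J : 𝒞} [Injective J] (A : Subobject J) :
    ∃ H : Subobject J, A ≤ H ∧ (∃ r : J ⟶ (H : 𝒞), H.arrow ≫ r = 𝟙 _) ∧
      ∀ U ≤ H, Disjoint A U → U = ⊥ := by
  obtain ⟨B, -, hB⟩ := exists_maximal_disjoint (disjoint_bot_right : Disjoint A ⊥)
  obtain ⟨H, hAH, hH⟩ := exists_maximal_disjoint hB.prop.symm
  have hmono : Mono (H.arrow ≫ cokernel.π B.arrow) := disjoint_iff_mono.1 hH.prop.symm
  -- the inclusion of `H` extends along the monomorphism `H ⟶ J / B`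
  obtain ⟨g, hg⟩ : ∃ g, (H.arrow ≫ cokernel.π B.arrow) ≫ g = H.arrow :=
    ⟨Injective.factorThru H.arrow _, Injective.comp_factorThru _ _⟩
  let φ : J ⟶ J := cokernel.π B.arrow ≫ g
  have hφH : H.arrow ≫ φ = H.arrow := (Category.assoc _ _ _).symm.trans hg
  have hφ : ∀ {T : 𝒞} (f : T ⟶ J), H.Factors f → f ≫ φ = f := fun f hf => by
    rw [← Subobject.factorThru_arrow H f hf, Category.assoc, hφH]
  have hBφ : ∀ {T : 𝒞} (f : T ⟶ J), B.Factors f → f ≫ φ = 0 := fun f hf => by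
    rw [factors_iff_comp_cokernel] at hf
    simp only [φ]
    rw [reassoc_of% hf, zero_comp]
  have hAfac : ∀ {T : 𝒞} (f : T ⟶ J), A.Factors f → H.Factors f := fun f hf =>
    Subobject.factors_of_le f hAH hf
  let W : Subobject J := imageSubobject φ
  have hHW : H ≤ W := Subobject.le_of_factors <| by
    have := imageSubobject_factors_comp_self φ H.arrow
    rwa [hφH] at this
  have hWB : Disjoint B W := by
    let V : Subobject J := (Subobject.pullback φ).obj (B ⊓ W)
    have hV : ∀ {T : 𝒞} (f : T ⟶ J), V.Factors f ↔ (B ⊓ W).Factors (f ≫ φ) := fun f =>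
      Limits.pullback_factors_iff _ _ _
    have hVB : V ≤ B := by
      refine hB.le_of_ge (disjoint_iff_factors.2 fun T f hA hf => ?_)
        (Subobject.le_of_factors ?_)
      · rw [hV, hφ f (hAfac f hA), Subobject.inf_factors] at hf
        exact disjoint_iff_factors.1 hB.prop f hA hf.1
      · rw [hV, hBφ _ B.factors_self]
        exact Subobject.factors_zero
    refine disjoint_iff_factors.2 fun T f hfB hfW => ?_
    -- after an epimorphism, `f` lifts along `φ`, and the lift lies in `V ≤ B = ker φ`
    let q := W.factorThru f hfW
    have hsq : pullback.fst q (factorThruImageSubobject φ) ≫ f =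
        pullback.snd q (factorThruImageSubobject φ) ≫ φ := by
      have h1 := pullback.condition (f := q) (g := factorThruImageSubobject φ) =≫ W.arrow
      simp only [Category.assoc] at h1
      rwa [Subobject.factorThru_arrow, imageSubobject_arrow_comp] at h1
    rw [← cancel_epi (pullback.fst q (factorThruImageSubobject φ)), comp_zero, hsq]
    refine hBφ _ (Subobject.factors_of_le _ hVB ((hV _).2 ?_))
    rw [← hsq, Subobject.inf_factors]
    exact ⟨Subobject.factors_of_factors_right _ hfB, Subobject.factors_of_factors_right _ hfW⟩
  have hWH : W ≤ H := hH.le_of_ge hWB hHW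
  refine ⟨H, hAH, ⟨factorThruImageSubobject φ ≫ Subobject.ofLE _ _ hWH, ?_⟩, fun U hU hAU => ?_⟩
  · rw [← cancel_mono H.arrow]
    simp only [Category.assoc, Subobject.ofLE_arrow, imageSubobject_arrow_comp, Category.id_comp]
    exact hφH
  · -- the preimage of the image of `U` in `J / B` is disjoint from `A`
    have hUmono : Mono (U.arrow ≫ cokernel.π B.arrow) :=
      disjoint_iff_mono.1 (hH.prop.symm.mono_left hU)
    let V : Subobject J :=
      (Subobject.pullback (cokernel.π B.arrow)).obj (Subobject.mk (U.arrow ≫ cokernel.π B.arrow))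
    have hV : ∀ {T : 𝒞} (f : T ⟶ J), V.Factors f ↔
        (Subobject.mk (U.arrow ≫ cokernel.π B.arrow)).Factors (f ≫ cokernel.π B.arrow) :=
      fun f => Limits.pullback_factors_iff _ _ _
    have hVB : V ≤ B := by
      refine hB.le_of_ge (disjoint_iff_factors.2 fun T f hA hf => ?_)
        (Subobject.le_of_factors ?_)
      · rw [hV] at hf
        obtain ⟨k, hk⟩ : ∃ k : T ⟶ (U : 𝒞), k ≫ U.arrow ≫ cokernel.π B.arrow =
          f ≫ cokernel.π B.arrow :=
          (Subobject.mk_factors_iff (U.arrow ≫ cokernel.π B.arrow) _).1 hf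
        have h1 : H.Factors (f - k ≫ U.arrow) := by
          have h2 : H.Factors (k ≫ U.arrow) :=
            Subobject.factors_of_le _ hU (Subobject.factors_comp_arrow k)
          rw [← Subobject.factorThru_arrow H f (hAfac f hA),
            ← Subobject.factorThru_arrow H _ h2, ← Preadditive.sub_comp]
          exact Subobject.factors_comp_arrow _
        have h3 : f - k ≫ U.arrow = 0 := by
          refine disjoint_iff_factors.1 hH.prop _ ?_ h1
          rw [factors_iff_comp_cokernel, Preadditive.sub_comp, Category.assoc, hk, sub_self]
        rw [sub_eq_zero] at h3
        exact disjoint_iff_factors.1 hAU f hA (h3 ▸ Subobject.factors_comp_arrow k)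
      · rw [hV, (factors_iff_comp_cokernel _ _).1 B.factors_self]
        exact Subobject.factors_zero
    have hUV : U ≤ V := Subobject.le_of_factors ((hV _).2 (Subobject.mk_factors_self _))
    exact (hH.prop.mono (hUV.trans hVB) hU).eq_bot_of_self

end GrothendieckLattice

/-! ### The Serre subcategory generated by the `X i` -/

section

attribute [local instance] CategoryTheory.Abelian.hasFiniteBiproducts

open scoped ZeroObject

namespace OrderedGrothendieck

section Serre

variable {𝒞 : Type u} [Category.{v} 𝒞] [Abelian 𝒞]

theorem prop_of_finite_biproduct (P : ObjectProperty 𝒞) [P.IsSerreClass] {J : Type*} [Finite J]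
    (f : J → 𝒞) (hf : ∀ j, P (f j)) : P (⨁ f) := by
  have : P.IsClosedUnderBinaryProducts := ⟨fun X ⟨p⟩ => by
    let A := p.diag.obj ⟨.left⟩
    let B := p.diag.obj ⟨.right⟩
    let l : X ⟶ A := p.π.app ⟨.left⟩
    let r : X ⟶ B := p.π.app ⟨.right⟩
    have : Mono (biprod.lift l r) := by
      refine Preadditive.mono_of_cancel_zero _ fun {T} g hg => ?_
      refine p.isLimit.hom_ext ?_
      rintro ⟨_ | _⟩
      · simpa [l] using hg =≫ biprod.fst
      · simpa [r] using hg =≫ biprod.snd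
    exact P.prop_of_mono (biprod.lift l r) (P.prop_biprod (p.prop_diag_obj _) (p.prop_diag_obj _))⟩
  have : P.IsClosedUnderFiniteProducts := .mk'
  exact P.prop_of_iso (biproduct.isoProduct f).symm (P.prop_product hf)

/-- A morphism induces a monomorphism on the quotient by its kernel. -/
theorem mono_cokernel_desc {M Z : 𝒞} (Y : Subobject M) (f : M ⟶ Z) (h0 : Y.arrow ≫ f = 0)
    (h : ∀ ⦃T : 𝒞⦄ (g : T ⟶ M), g ≫ f = 0 → Y.Factors g) : Mono (cokernel.desc Y.arrow f h0) := by
  refine Preadditive.mono_of_cancel_zero _ fun {T} g hg => ?_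
  have h1 := pullback.condition (f := g) (g := cokernel.π Y.arrow)
  have h2 : pullback.snd g (cokernel.π Y.arrow) ≫ f = 0 := by
    have := h1 =≫ cokernel.desc Y.arrow f h0
    simp only [Category.assoc, hg, comp_zero, cokernel.π_desc] at this
    exact this.symm
  rw [← cancel_epi (pullback.fst g (cokernel.π Y.arrow)), comp_zero, h1]
  exact (GrothendieckLattice.factors_iff_comp_cokernel _ _).1 (h _ h2)

theorem IsSubquotient.trans_of_mono {N M M' : 𝒞} (h : IsSubquotient N M) (i : M ⟶ M') [Mono i] :
    IsSubquotient N M' := by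
  obtain ⟨Z, π, j, _, _⟩ := h
  exact ⟨pushout i π, pushout.inl i π, j ≫ pushout.inr i π, inferInstance, inferInstance⟩

omit [Abelian 𝒞] in
theorem IsSubquotient.trans_of_epi {N M M' : 𝒞} (h : IsSubquotient N M) (p : M' ⟶ M) [Epi p] :
    IsSubquotient N M' := by
  obtain ⟨Z, π, j, _, _⟩ := h
  exact ⟨Z, p ≫ π, j, inferInstance, inferInstance⟩

/-- Every nonzero subquotient has a simple subobject. -/
def SubquotientsHaveSimple : ObjectProperty 𝒞 :=
  fun M => ∀ N : 𝒞, IsSubquotient N M → ¬ IsZero N → ∃ (S : 𝒞) (i : S ⟶ N), Simple S ∧ Mono i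

instance : (SubquotientsHaveSimple (𝒞 := 𝒞)).IsSerreClass where
  exists_zero := by
    refine ⟨0, isZero_zero _, fun N ⟨Z, π, j, _, _⟩ hN => (hN ?_).elim⟩
    exact IsZero.of_mono j (IsZero.of_epi π (isZero_zero 𝒞))
  prop_of_mono i _ h := fun N hN => h N (hN.trans_of_mono i)
  prop_of_epi p _ h := fun N hN => h N (hN.trans_of_epi p)
  prop_X₂_of_shortExact {E} hE h₁ h₃ := by
    rintro N ⟨Z, π, j, _, _⟩ hN
    -- `Z` is an extension of a quotient of `X₃` by a quotient of `X₁`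
    let a := E.f ≫ π
    have := hE.epi_g
    have hq : E.f ≫ π ≫ cokernel.π a = 0 := by
      rw [← Category.assoc]; exact cokernel.condition a
    let b : E.X₃ ⟶ cokernel a := hE.gIsCokernel.desc (CokernelCofork.ofπ _ hq)
    have hb : E.g ≫ b = π ≫ cokernel.π a := hE.gIsCokernel.fac _ WalkingParallelPair.one
    have : Epi (E.g ≫ b) := by rw [hb]; infer_instance
    have : Epi b := epi_of_epi E.g b
    let q := j ≫ cokernel.π a
    by_cases hker : IsZero (kernel q)
    · have : Mono q := Preadditive.mono_of_isZero_kernel q hker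
      exact h₃ N ⟨_, b, q, inferInstance, inferInstance⟩ hN
    · let l : kernel q ⟶ Abelian.image a := kernel.lift _ (kernel.ι q ≫ j) (by
        rw [Category.assoc]; exact kernel.condition q)
      have hl : l ≫ Abelian.image.ι a = kernel.ι q ≫ j := kernel.lift_ι _ _ _
      have : Mono (l ≫ Abelian.image.ι a) := by rw [hl]; infer_instance
      have : Mono l := mono_of_mono l (Abelian.image.ι a)
      obtain ⟨S, i, hS, _⟩ := h₁ (kernel q)
        ⟨_, Abelian.factorThruImage a, l, inferInstance, inferInstance⟩ hker
      exact ⟨S, i ≫ kernel.ι q, hS, inferInstance⟩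

theorem subquotientsHaveSimple_of_simple (S : 𝒞) [Simple S] : SubquotientsHaveSimple S := by
  rintro N ⟨Z, π, j, _, _⟩ hN
  have hj : j ≠ 0 := fun h => hN (IsZero.of_mono_eq_zero j h)
  have hπ : π ≠ 0 := fun h => hN (IsZero.of_mono j (IsZero.of_epi_eq_zero π h))
  have := isIso_of_epi_of_nonzero hπ
  have : Simple Z := Simple.of_iso (asIso π).symm
  have := isIso_of_mono_of_nonzero hj
  exact ⟨S, π ≫ inv j, inferInstance, inferInstance⟩

/-- Objects with finite dimensional space of morphisms to `E`. -/
def HomFinite (K : Type*) [Field K] [Linear K 𝒞] (E : 𝒞) : ObjectProperty 𝒞 :=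
  fun M => FiniteDimensional K (M ⟶ E)

instance (K : Type*) [Field K] [Linear K 𝒞] (E : 𝒞) [Injective E] :
    (HomFinite K E).IsSerreClass where
  exists_zero := by
    refine ⟨0, isZero_zero _, ?_⟩
    have : Subsingleton ((0 : 𝒞) ⟶ E) := ⟨fun f g => (isZero_zero 𝒞).eq_of_src f g⟩
    exact Module.Finite.of_finite
  prop_of_mono {X Y} i _ h := by
    have : FiniteDimensional K (Y ⟶ E) := h
    exact Module.Finite.of_surjective (Linear.leftComp K E i)
      fun f => ⟨Injective.factorThru f i, Injective.comp_factorThru f i⟩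
  prop_of_epi {X Y} p _ h := by
    have : FiniteDimensional K (X ⟶ E) := h
    exact FiniteDimensional.of_injective (Linear.leftComp K E p)
      fun f g hfg => (cancel_epi p).1 hfg
  prop_X₂_of_shortExact {S} hS h₁ h₃ := by
    have : FiniteDimensional K (S.X₁ ⟶ E) := h₁
    have : FiniteDimensional K (S.X₃ ⟶ E) := h₃
    have := hS.epi_g
    let a := Linear.leftComp K E S.f
    have h : LinearMap.ker a ≤ LinearMap.range (Linear.leftComp K E S.g) := fun f hf => by
      have hf : S.f ≫ f = 0 := hf
      exact ⟨hS.gIsCokernel.desc (CokernelCofork.ofπ _ hf),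
        hS.gIsCokernel.fac _ WalkingParallelPair.one⟩
    have : FiniteDimensional K (LinearMap.ker a) := Submodule.finiteDimensional_of_le h
    have : FiniteDimensional K ((S.X₂ ⟶ E) ⧸ LinearMap.ker a) :=
      Module.Finite.equiv a.quotKerEquivRange.symm
    exact Module.Finite.of_submodule_quotient (LinearMap.ker a)

end Serre

section Fin

variable {𝒞 : Type u} [Category.{v} 𝒞] [Abelian 𝒞] {I : Type w} [PartialOrder I]
  (G : OrderedGrothendieckStructure 𝒞 I)

instance isSerreClass_fin : G.fin.IsSerreClass where
  exists_zero := ⟨0, isZero_zero _, fun P _ _ => P.prop_zero⟩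
  prop_of_mono i _ h := fun P hP hX => P.prop_of_mono i (h P hP hX)
  prop_of_epi p _ h := fun P hP hX => P.prop_of_epi p (h P hP hX)
  prop_X₂_of_shortExact hS h₁ h₃ := fun P hP hX =>
    P.prop_X₂_of_shortExact hS (h₁ P hP hX) (h₃ P hP hX)

theorem fin_X (i : I) : G.fin (G.X i) := fun _ _ h => h i

theorem fin_of_isSubquotientOfSum {N : 𝒞} (h : IsSubquotientOfSum G.X N) : G.fin N := by
  obtain ⟨n, a, Z, π, j, _, _⟩ := h
  exact G.fin.prop_of_mono j (G.fin.prop_of_epi π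
    (prop_of_finite_biproduct G.fin _ fun k => fin_X G (a k)))

include G in
theorem wellFoundedLT_index : WellFoundedLT I := by
  have : StrictMono fun i : I => (Set.Iic i).ncard := fun i j hij =>
    Set.ncard_lt_ncard (Set.Iic_ssubset_Iic.2 hij) (G.finite_downset j)
  exact this.wellFoundedLT

theorem factors_interKer_iff (i : I) {T : 𝒞} (g : T ⟶ G.X i) :
    (interKer G.X (G.Θ i)).Factors g ↔ ∀ θ ∈ G.Θ i, g ≫ θ.2 = 0 := by
  unfold interKer
  rw [Subobject.finset_inf_factors]
  simp only [kernelSubobject_factors_iff]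

/-- The morphisms in `Θ i` embed `X i / Y i` into a finite direct sum of objects `X j`, `j < i`. -/
theorem exists_mono_cokernel_interKer (i : I) :
    ∃ m : cokernel (interKer G.X (G.Θ i)).arrow ⟶ ⨁ fun θ : G.Θ i => G.X θ.1.1, Mono m := by
  have h0 : (interKer G.X (G.Θ i)).arrow ≫
      biproduct.lift (fun θ : G.Θ i => θ.1.2) = 0 := by
    ext θ
    simpa using (factors_interKer_iff G i _).1 (Subobject.factors_self _) θ.1 θ.2
  refine ⟨cokernel.desc _ _ h0, mono_cokernel_desc _ _ h0 fun T g hg => ?_⟩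
  refine (factors_interKer_iff G i g).2 fun θ hθ => ?_
  simpa using hg =≫ biproduct.π _ ⟨θ, hθ⟩

/-- A Serre class that contains the simple objects contains all objects of `G.fin`. -/
theorem fin_le_of_simple (P : ObjectProperty 𝒞) [hP : P.IsSerreClass] (h : ∀ S : 𝒞, Simple S → P S)
    {M : 𝒞} (hM : G.fin M) : P M := by
  have := wellFoundedLT_index G
  refine hM P hP fun i => ?_
  induction i using WellFoundedLT.induction with
  | ind i ih =>
    obtain ⟨n, S, S', p, hS, -, -, ⟨e⟩, -⟩ := G.decomposition i
    obtain ⟨m, _⟩ := exists_mono_cokernel_interKer G i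
    have h1 : P (interKer G.X (G.Θ i) : 𝒞) :=
      P.prop_of_iso e.symm (prop_of_finite_biproduct P _ fun q => h _ (hS q.1))
    have h2 : P (cokernel (interKer G.X (G.Θ i)).arrow) :=
      P.prop_of_mono m (prop_of_finite_biproduct P _ fun θ => ih _ θ.1.1.2)
    exact P.prop_X₂_of_shortExact (S := ShortComplex.mk (interKer G.X (G.Θ i)).arrow
      (cokernel.π _) (cokernel.condition _))
      { exact := ShortComplex.exact_cokernel _ } h1 h2

/-- Every object is the sum of its subobjects in `G.fin`. -/
theorem isLUB_fin (M : 𝒞) : IsLUB {N : Subobject M | G.fin (N : 𝒞)} ⊤ :=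
  ⟨fun _ _ => le_top, fun _ hU => (G.generates M).2 fun _ hN =>
    hU (fin_of_isSubquotientOfSum G hN)⟩

include G in
theorem exists_simple_mono {M : 𝒞} (hM : ¬ IsZero M) :
    ∃ (S : 𝒞) (i : S ⟶ M), Simple S ∧ Mono i := by
  obtain ⟨N, hN, hN0⟩ : ∃ N : Subobject M, G.fin (N : 𝒞) ∧ ¬ IsZero (N : 𝒞) := by
    by_contra! hc
    have h1 : (⊤ : Subobject M) ≤ ⊥ := (isLUB_fin G M).2 fun N hN => by
      rw [← Subobject.mk_arrow N, Subobject.mk_eq_bot_iff_zero.2 ((hc N hN).eq_of_src _ _)]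
    have h2 : (⊤ : Subobject M).arrow = 0 := by
      rw [← Subobject.bot_factors_iff_zero, ← le_bot_iff.1 h1]
      exact Subobject.factors_self _
    exact hM (IsZero.of_epi_eq_zero _ h2)
  obtain ⟨S, i, hS, _⟩ := fin_le_of_simple G SubquotientsHaveSimple
    (fun S hS => subquotientsHaveSimple_of_simple S) hN _
    ⟨_, 𝟙 _, 𝟙 _, inferInstance, inferInstance⟩ hN0
  exact ⟨S, i ≫ N.arrow, hS, inferInstance⟩

end Fin

end OrderedGrothendieck

end

/-! ### Essential simple subobjects and the injective cogenerator -/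

section

attribute [local instance] CategoryTheory.Abelian.hasFiniteBiproducts

open scoped ZeroObject

namespace OrderedGrothendieck

section Essential

variable {𝒞 : Type u} [Category.{v} 𝒞] [Abelian 𝒞]

/-- An essential monomorphism: a morphism out of `E` is a monomorphism as soon as its restriction
along `i` is one. -/
def EssentialMono {A E : 𝒞} (i : A ⟶ E) : Prop :=
  Mono i ∧ ∀ ⦃Z : 𝒞⦄ (g : E ⟶ Z), Mono (i ≫ g) → Mono g

omit [Abelian 𝒞] in
theorem EssentialMono.comp_isIso {A E E' : 𝒞} {i : A ⟶ E} (h : EssentialMono i) (e : E ⟶ E')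
    [IsIso e] : EssentialMono (i ≫ e) := by
  have := h.1
  refine ⟨inferInstance, fun Z g hg => ?_⟩
  rw [Category.assoc] at hg
  have := h.2 _ hg
  have h1 : g = inv e ≫ e ≫ g := by simp
  rw [h1]
  infer_instance

/-- An essential simple subobject is contained in every nonzero subobject. -/
theorem EssentialMono.factors {S E : 𝒞} [Simple S] {i : S ⟶ E} (h : EssentialMono i)
    (U : Subobject E) (hU : U.arrow ≠ 0) : U.Factors i := by
  rw [GrothendieckLattice.factors_iff_comp_cokernel]
  by_contra hne
  have := h.2 _ (mono_of_nonzero_from_simple hne)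
  exact hU (zero_of_comp_mono (cokernel.π U.arrow) (cokernel.condition _))

/-- Every morphism from a simple object factors through an essential simple subobject. -/
theorem EssentialMono.exists_fac {S E T : 𝒞} [Simple S] [Simple T] {i : S ⟶ E}
    (h : EssentialMono i) (t : T ⟶ E) : ∃ k : T ⟶ S, k ≫ i = t := by
  by_cases ht : t = 0
  · exact ⟨0, by simp [ht]⟩
  have := mono_of_nonzero_from_simple ht
  have h1 : (Subobject.mk t).arrow ≠ 0 := fun h0 => by
    apply ht
    rw [← Subobject.underlyingIso_hom_comp_eq_mk, ← comp_zero (X := _) (Z := E)] at h0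
    exact (cancel_epi _).1 h0
  obtain ⟨k, hk⟩ : ∃ k : S ⟶ T, k ≫ t = i :=
    (Subobject.mk_factors_iff t i).1 (h.factors (Subobject.mk t) h1)
  have hk0 : k ≠ 0 := fun h0 => by
    have := h.1
    exact id_nonzero S ((cancel_mono i).1 (by rw [← hk, h0]; simp))
  have := isIso_of_hom_simple hk0
  exact ⟨inv k, by rw [← hk]; simp⟩

theorem finiteDimensional_hom_simple {K : Type*} [Field K] [Linear K 𝒞] {S : 𝒞} [Simple S]
    (hS : FiniteDimensional K (S ⟶ S)) (T : 𝒞) [Simple T] : FiniteDimensional K (T ⟶ S) := by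
  by_cases h : ∃ k : T ⟶ S, k ≠ 0
  · obtain ⟨k, hk⟩ := h
    have := isIso_of_hom_simple hk
    exact FiniteDimensional.of_injective (Linear.leftComp K S (inv k))
      fun f g hfg => (cancel_epi (inv k)).1 hfg
  · have : Subsingleton (T ⟶ S) := ⟨fun f g => by
      rw [not_exists] at h
      rw [not_not.1 (h f), not_not.1 (h g)]⟩
    exact Module.Finite.of_finite

theorem EssentialMono.homFinite_simple {K : Type*} [Field K] [Linear K 𝒞] {S E : 𝒞} [Simple S]
    {i : S ⟶ E} (h : EssentialMono i) (hS : FiniteDimensional K (S ⟶ S)) (T : 𝒞) [Simple T] :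
    HomFinite K E T := by
  have := finiteDimensional_hom_simple hS T
  exact Module.Finite.of_surjective (Linear.rightComp K T i) h.exists_fac

/-- If `T ⟶ E` is nonzero, `S ⟶ E` is an essential monomorphism and `S`, `T` are simple then
`S ≅ T`. -/
theorem EssentialMono.nonempty_iso {S E T : 𝒞} [Simple S] [Simple T] {i : S ⟶ E}
    (h : EssentialMono i) {t : T ⟶ E} (ht : t ≠ 0) : Nonempty (T ≅ S) := by
  obtain ⟨k, rfl⟩ := h.exists_fac t
  have : k ≠ 0 := fun h0 => ht (by simp [h0])
  have := isIso_of_hom_simple this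
  exact ⟨asIso k⟩

variable [IsGrothendieckAbelian.{v} 𝒞]

/-- An injective object contains an injective hull of each of its subobjects as a retract. -/
theorem exists_essentialMono_retract {A J : 𝒞} [Injective J] (i : A ⟶ J) [Mono i] :
    ∃ (H : 𝒞) (r : Retract H J) (k : A ⟶ H), k ≫ r.i = i ∧ EssentialMono k := by
  obtain ⟨H, hAH, ⟨r, hr⟩, hess⟩ := GrothendieckLattice.exists_injectiveHull (Subobject.mk i)
  let k : A ⟶ (H : 𝒞) := Subobject.ofMkLE i H hAH
  have hk : k ≫ H.arrow = i := Subobject.ofMkLE_arrow hAH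
  have : Mono (k ≫ H.arrow) := by rw [hk]; infer_instance
  have : Mono k := mono_of_mono k H.arrow
  refine ⟨H, ⟨H.arrow, r, hr⟩, k, hk, ‹_›, fun Z g hg => ?_⟩
  refine Preadditive.mono_of_kernel_zero ?_
  have h1 := hess (Subobject.mk (kernel.ι g ≫ H.arrow))
    (Subobject.mk_le_of_comm (kernel.ι g) rfl) ?_
  · rw [Subobject.mk_eq_bot_iff_zero] at h1
    exact zero_of_comp_mono _ h1
  · refine GrothendieckLattice.disjoint_iff_factors.2 fun T f hf hf' => ?_
    obtain ⟨a, rfl⟩ : ∃ a : T ⟶ A, a ≫ i = f := (Subobject.mk_factors_iff i f).1 hf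
    obtain ⟨b, hb⟩ : ∃ b : T ⟶ kernel g, b ≫ kernel.ι g ≫ H.arrow = a ≫ i :=
      (Subobject.mk_factors_iff (kernel.ι g ≫ H.arrow) _).1 hf'
    have h2 : b ≫ kernel.ι g = a ≫ k := by
      rw [← cancel_mono H.arrow, Category.assoc, hb, Category.assoc, hk]
    have h3 : a ≫ k ≫ g = 0 := by
      rw [← Category.assoc, ← h2, Category.assoc, kernel.condition, comp_zero]
    rw [zero_of_comp_mono (k ≫ g) h3, zero_comp]

/-- A nonzero subobject of an indecomposable injective object is essential. -/
theorem essentialMono_of_indecomposable {A J : 𝒞} [Injective J] (hJ : Indecomposable J)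
    (hA : ¬ IsZero A) (i : A ⟶ J) [Mono i] : EssentialMono i := by
  obtain ⟨H, r, k, rfl, hk⟩ := exists_essentialMono_retract i
  have : IsSplitMono r.i := ⟨⟨⟨r.r, r.retract⟩⟩⟩
  have e : J ≅ H ⊞ cokernel r.i := biprod.uniqueUpToIso _ _
    (isBilimitBinaryBiconeOfIsSplitMonoOfCokernel (cokernelIsCokernel r.i))
  have := hk.1
  have h1 : ¬ IsZero H := fun h => hA (IsZero.of_mono k h)
  have h2 : IsZero (cokernel r.i) := (hJ.2 _ _ e).resolve_left h1
  have : Epi r.i := Preadditive.epi_of_isZero_cokernel _ h2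
  have : IsIso r.i := isIso_of_mono_of_epi _
  exact hk.comp_isIso r.i

end Essential

section Linear

variable {K : Type v} [Field K] {𝒞 : Type u} [Category.{v} 𝒞] [Abelian 𝒞] [Linear K 𝒞]
  [IsGrothendieckAbelian.{v} 𝒞]

/-- Up to isomorphism the simple objects form a set. -/
theorem exists_simple_representatives (𝒞 : Type u) [Category.{v} 𝒞] [Abelian 𝒞]
    [IsGrothendieckAbelian.{v} 𝒞] : ∃ (Λ : Type v) (S : Λ → 𝒞), (∀ l, Simple (S l)) ∧
      (∀ l l', Nonempty (S l ≅ S l') → l = l') ∧ ∀ T : 𝒞, Simple T → ∃ l, Nonempty (T ≅ S l) := by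
  let X : 𝒞 := separator 𝒞
  -- every simple object is a quotient of the separator, which has a small set of subobjects
  obtain ⟨Λ₀, ⟨σ⟩⟩ : ∃ Λ₀ : Type v,
      Nonempty (Λ₀ ≃ {N : Subobject X // Simple (cokernel N.arrow)}) :=
    ⟨_, ⟨(equivShrink.{v} _).symm⟩⟩
  let S₀ : Λ₀ → 𝒞 := fun l => cokernel (σ l).1.arrow
  let s : Setoid Λ₀ :=
    { r := fun l l' => Nonempty (S₀ l ≅ S₀ l')
      iseqv := ⟨fun _ => ⟨Iso.refl _⟩, fun ⟨e⟩ => ⟨e.symm⟩, fun ⟨e⟩ ⟨e'⟩ => ⟨e ≪≫ e'⟩⟩ }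
  refine ⟨Quotient s, fun l => S₀ l.out, fun l => (σ l.out).2,
    fun l l' h => ?_, fun T hT => ?_⟩
  · rw [← Quotient.out_eq l, ← Quotient.out_eq l']
    exact Quotient.sound h
  · obtain ⟨g, hg⟩ : ∃ g : X ⟶ T, g ≠ 0 := by
      by_contra! hc
      refine id_nonzero T ((isSeparator_separator 𝒞).def _ _ fun h => ?_)
      rw [hc (h ≫ 𝟙 T), hc (h ≫ 0)]
    have : Epi g := epi_of_nonzero_to_simple hg
    let N : Subobject X := kernelSubobject g
    have hz : N.arrow ≫ g = 0 := kernelSubobject_arrow_comp g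
    have : Mono (cokernel.desc N.arrow g hz) := mono_cokernel_desc N g hz fun T' f hf =>
      (kernelSubobject_factors_iff g f).2 hf
    have : Epi (cokernel.π N.arrow ≫ cokernel.desc N.arrow g hz) := by
      rw [cokernel.π_desc]; infer_instance
    have : Epi (cokernel.desc N.arrow g hz) := epi_of_epi (cokernel.π N.arrow) _
    have : IsIso (cokernel.desc N.arrow g hz) := isIso_of_mono_of_epi _
    have e : T ≅ cokernel N.arrow := (asIso (cokernel.desc N.arrow g hz)).symm
    have hs : Simple (cokernel N.arrow) := Simple.of_iso e.symm
    obtain ⟨l, hl⟩ := σ.surjective ⟨N, hs⟩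
    have hl : S₀ l = cokernel N.arrow := congrArg
      (fun M : {N : Subobject X // Simple (cokernel N.arrow)} => cokernel M.1.arrow) hl
    obtain ⟨e'⟩ : Nonempty (S₀ (Quotient.mk s l).out ≅ S₀ l) := Quotient.mk_out (s := s) l
    exact ⟨Quotient.mk s l, ⟨e ≪≫ eqToIso hl.symm ≪≫ e'.symm⟩⟩

variable {I : Type w} [PartialOrder I] (G : OrderedGrothendieckStructure 𝒞 I)

omit [IsGrothendieckAbelian.{v} 𝒞] in
theorem homFinite_fin {E : 𝒞} [Injective E] (h : ∀ T : 𝒞, Simple T → HomFinite K E T) {M : 𝒞}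
    (hM : G.fin M) : HomFinite K E M :=
  fin_le_of_simple G (HomFinite K E) h hM

include G in
/-- The product of the injective hulls of representatives of the simple objects is an injective
cogenerator into which every object of `G.fin` has a finite dimensional space of morphisms. -/
theorem exists_injective_cogenerator
    (hEnd : ∀ S : 𝒞, Simple S → FiniteDimensional K (S ⟶ S)) :
    ∃ E : 𝒞, Injective E ∧ (∀ M, G.fin M → HomFinite K E M) ∧
      ∀ M : 𝒞, ¬ IsZero M → ∃ f : M ⟶ E, f ≠ 0 := by
  classical
  obtain ⟨Λ, S, hS, hinj, hsurj⟩ := exists_simple_representatives 𝒞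
  have hull : ∀ l, ∃ (E : 𝒞) (i : S l ⟶ E), Injective E ∧ EssentialMono i := fun l => by
    obtain ⟨H, r, k, -, hk⟩ := exists_essentialMono_retract (Injective.ι (S l))
    exact ⟨H, k, r.injective, hk⟩
  choose E i hE hi using hull
  have hEinj : Injective (∏ᶜ E) := inferInstance
  refine ⟨∏ᶜ E, hEinj, fun M hM => homFinite_fin G (fun T hT => ?_) hM, fun M hM => ?_⟩
  · obtain ⟨l, ⟨e⟩⟩ := hsurj T hT
    have := (hi l).homFinite_simple (hEnd _ (hS l)) T
    have : FiniteDimensional K (T ⟶ E l) := this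
    -- only the component at the isomorphism class of `T` can be nonzero
    refine FiniteDimensional.of_injective (Linear.rightComp K T (Pi.π E l)) fun f g hfg => ?_
    refine Pi.hom_ext _ _ fun l' => ?_
    by_cases hl : l' = l
    · subst hl; exact hfg
    · have hz : ∀ t : T ⟶ E l', t = 0 := fun t => by
        by_contra ht
        obtain ⟨e'⟩ := (hi l').nonempty_iso ht
        exact hl (hinj _ _ ⟨e'.symm ≪≫ e⟩)
      rw [hz (f ≫ _), hz (g ≫ _)]
  · obtain ⟨T, j, hT, _⟩ := exists_simple_mono G hM
    obtain ⟨l, ⟨e⟩⟩ := hsurj T hT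
    let t : T ⟶ ∏ᶜ E := Pi.lift fun l' => if h : l' = l then e.hom ≫ eqToHom (by rw [h]) ≫ i l'
      else 0
    have ht : t ≠ 0 := fun h0 => by
      have h1 := h0 =≫ Pi.π E l
      simp only [t, Pi.lift_π, zero_comp] at h1
      have := (hi l).1
      have h2 : e.hom ≫ i l = 0 := by simpa using h1
      have : e.hom = 0 := zero_of_comp_mono _ h2
      exact id_nonzero T (by rw [← e.hom_inv_id, this, zero_comp])
    refine ⟨Injective.factorThru t j, fun h0 => ht ?_⟩
    rw [← Injective.comp_factorThru t j, h0, comp_zero]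

omit [IsGrothendieckAbelian.{v} 𝒞] in
theorem factors_of_biproduct {J : Type*} [Finite J] {X : J → 𝒞} {E : 𝒞} (U : Subobject E)
    (f : (⨁ X) ⟶ E) (h : ∀ j, U.Factors (biproduct.ι X j ≫ f)) : U.Factors f := by
  have h1 : f = (biproduct.desc fun j => U.factorThru (biproduct.ι X j ≫ f) (h j)) ≫ U.arrow := by
    ext j
    simp
  rw [h1]
  exact Subobject.factors_comp_arrow _

/-- An injective object with an essential simple subobject `S` belongs to `G.fin`: it is the sum of
the images of the finitely many members of a basis of `X i ⟶ E`, where `S` is a summand of `Y i`. -/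
theorem fin_of_essentialMono {S E : 𝒞} [Simple S] [Injective E] {i : S ⟶ E}
    (hi : EssentialMono i) (hS : FiniteDimensional K (S ⟶ S)) : G.fin E := by
  have hfin : ∀ j, FiniteDimensional K (G.X j ⟶ E) := fun j =>
    homFinite_fin G (fun T _ => hi.homFinite_simple hS T) (fin_X G j)
  obtain ⟨U, hUfin, hU⟩ : ∃ U : Subobject E, G.fin (U : 𝒞) ∧ ∀ j,
      IsSimpleSummand S (interKer G.X (G.Θ j) : 𝒞) → ∀ f : G.X j ⟶ E, U.Factors f := by
    by_cases h : ∃ j, IsSimpleSummand S (interKer G.X (G.Θ j) : 𝒞)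
    · obtain ⟨j, hj⟩ := h
      let b := Module.finBasis K (G.X j ⟶ E)
      let F : (⨁ fun _ : Fin (Module.finrank K (G.X j ⟶ E)) => G.X j) ⟶ E :=
        biproduct.desc fun k => b k
      refine ⟨imageSubobject F, G.fin.prop_of_epi (factorThruImageSubobject F)
        (prop_of_finite_biproduct G.fin _ fun _ => fin_X G j), fun j' hj' f => ?_⟩
      obtain rfl : j' = j := by
        by_contra hne
        exact G.disjoint j' j hne S hj' hj
      have h1 : f = (biproduct.lift fun k => b.repr f k • 𝟙 (G.X j')) ≫ F := by
        simp only [F, biproduct.lift_desc, Linear.smul_comp, Category.id_comp]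
        exact (b.sum_repr f).symm
      rw [h1]
      exact imageSubobject_factors_comp_self _ _
    · refine ⟨⊥, G.fin.prop_of_isZero ?_, fun j hj => (h ⟨j, hj⟩).elim⟩
      exact IsZero.of_mono_eq_zero (⊥ : Subobject E).arrow Subobject.bot_arrow
  have := wellFoundedLT_index G
  have key : ∀ j (f : G.X j ⟶ E), U.Factors f := fun j => by
    induction j using WellFoundedLT.induction with
    | ind j ih =>
      intro f
      by_cases hf : (interKer G.X (G.Θ j)).arrow ≫ f = 0
      · -- `f` factors through `X j / Y j`, hence extends to a sum of smaller `X j'`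
        obtain ⟨m, _⟩ := exists_mono_cokernel_interKer G j
        have h1 : f = (cokernel.π _ ≫ m) ≫ Injective.factorThru (cokernel.desc _ f hf) m := by
          rw [Category.assoc, Injective.comp_factorThru, cokernel.π_desc]
        rw [h1]
        exact Subobject.factors_of_factors_right _
          (factors_of_biproduct U _ fun θ => ih _ θ.1.1.2 _)
      · -- otherwise the simple object `S` is a direct summand of `Y j`
        refine hU j ⟨inferInstance, ?_⟩ f
        obtain ⟨n, T, T', p, hT, -, -, ⟨e⟩, -⟩ := G.decomposition j
        obtain ⟨q, hq⟩ : ∃ q, biproduct.ι (fun q : (Σ k : Fin n, Fin (p k)) => T q.1) q ≫ e.inv ≫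
            (interKer G.X (G.Θ j)).arrow ≫ f ≠ 0 := by
          by_contra! hc
          refine hf ((cancel_epi e.inv).1 ?_)
          ext q
          rw [hc q, comp_zero, comp_zero]
        have := hT q.1
        obtain ⟨k⟩ := hi.nonempty_iso hq
        exact ⟨⟨k.inv ≫ biproduct.ι (fun q : (Σ k : Fin n, Fin (p k)) => T q.1) q ≫ e.inv,
          e.hom ≫ biproduct.π _ q ≫ k.hom, by simp⟩⟩
  have htop : U = ⊤ := top_le_iff.1 <| (G.generates E).2 fun N hN => by
    obtain ⟨n, a, Z, π, j, _, _⟩ := hN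
    let h := Injective.factorThru N.arrow j
    have h1 : U.Factors (π ≫ h) :=
      factors_of_biproduct U _ fun k => key _ _
    rw [GrothendieckLattice.factors_iff_comp_cokernel, Category.assoc] at h1
    have h2 : U.Factors h := by
      rw [GrothendieckLattice.factors_iff_comp_cokernel]
      exact zero_of_epi_comp π h1
    refine Subobject.le_of_factors ?_
    rw [← Injective.comp_factorThru N.arrow j]
    exact Subobject.factors_of_factors_right _ h2
  subst htop
  exact G.fin.prop_of_iso (asIso (⊤ : Subobject E).arrow) hUfin

end Linear

end OrderedGrothendieck

end

/-! ### The continuous dual of `Hom (M, E)` -/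

section

open scoped ZeroObject

namespace ContDual

variable (K : Type v) [Field K] {𝒞 : Type u} [Category.{v} 𝒞] [Abelian 𝒞] [Linear K 𝒞]
  (P : ObjectProperty 𝒞) [P.IsSerreClass] (E : 𝒞)

/-- The functionals on `M ⟶ E` that factor through the restriction to an object of `P`: the
continuous dual of `M ⟶ E` for the topology in which the morphisms that vanish on a given `P`-object
over `M` form a basic neighbourhood of zero. -/
def space (M : 𝒞) : Submodule K (Module.Dual K (M ⟶ E)) where
  carrier := {φ | ∃ (N : 𝒞) (i : N ⟶ M), P N ∧ ∀ f : M ⟶ E, i ≫ f = 0 → φ f = 0}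
  zero_mem' := ⟨0, 0, P.prop_zero, fun _ _ => rfl⟩
  add_mem' := by
    rintro φ ψ ⟨N, i, hN, hi⟩ ⟨N', i', hN', hi'⟩
    refine ⟨N ⊞ N', biprod.desc i i', P.prop_biprod hN hN', fun f hf => ?_⟩
    have h1 : i ≫ f = 0 := by simpa using biprod.inl ≫= hf
    have h2 : i' ≫ f = 0 := by simpa using biprod.inr ≫= hf
    rw [LinearMap.add_apply, hi f h1, hi' f h2, add_zero]
  smul_mem' := by
    rintro c φ ⟨N, i, hN, hi⟩
    exact ⟨N, i, hN, fun f hf => by rw [LinearMap.smul_apply, hi f hf, smul_zero]⟩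

variable {M M' : 𝒞}

/-- The covariant functoriality of the continuous dual. -/
def map (g : M ⟶ M') : space K P E M →ₗ[K] space K P E M' :=
  LinearMap.codRestrict _ ((Linear.leftComp K E g).dualMap ∘ₗ (space K P E M).subtype) <| by
    rintro ⟨φ, N, i, hN, hi⟩
    exact ⟨N, i ≫ g, hN, fun f hf => hi (g ≫ f) (by rw [← hf, Category.assoc])⟩

/-- The continuous dual as a functor. -/
def functor : 𝒞 ⥤ ModuleCat.{v} K where
  obj M := ModuleCat.of K (space K P E M)
  map g := ModuleCat.ofHom (map K P E g)
  map_id _ := ModuleCat.hom_ext <| LinearMap.ext fun φ => Subtype.ext <| LinearMap.ext fun f =>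
    congrArg φ.1 (Category.id_comp f)
  map_comp g h := ModuleCat.hom_ext <| LinearMap.ext fun φ => Subtype.ext <| LinearMap.ext fun f =>
    congrArg φ.1 (Category.assoc g h f)

instance : (functor K P E).Additive where
  map_add {M M' g h} := ModuleCat.hom_ext <| LinearMap.ext fun φ => Subtype.ext <|
    LinearMap.ext fun f => by
      change φ.1 ((g + h) ≫ f) = φ.1 (g ≫ f) + φ.1 (h ≫ f)
      rw [Preadditive.add_comp, map_add]

instance : (functor K P E).Linear K where
  map_smul {M M'} g r := ModuleCat.hom_ext <| LinearMap.ext fun φ => Subtype.ext <|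
    LinearMap.ext fun f => by
      change φ.1 ((r • g) ≫ f) = r • φ.1 (g ≫ f)
      rw [Linear.smul_comp, map_smul]

/-- Evaluation at a morphism to `E`. -/
def eval (f : M ⟶ E) : space K P E M →ₗ[K] K where
  toFun φ := φ.1 f
  map_add' _ _ := rfl
  map_smul' _ _ := rfl

/-- A functional on `N ⟶ E` with `N` in `P`, as a functional on `M ⟶ E` for `i : N ⟶ M`. -/
def ofFunctional {N : 𝒞} (hN : P N) (i : N ⟶ M) : Module.Dual K (N ⟶ E) →ₗ[K] space K P E M :=
  LinearMap.codRestrict _ (Linear.leftComp K E i).dualMap fun ψ =>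
    ⟨N, i, hN, fun f hf => by
      change ψ (i ≫ f) = 0
      rw [hf, map_zero]⟩

theorem ofFunctional_apply {N : 𝒞} (hN : P N) (i : N ⟶ M) (ψ : Module.Dual K (N ⟶ E))
    (f : M ⟶ E) : (ofFunctional K P E hN i ψ).1 f = ψ (i ≫ f) := rfl

/-- An element of the continuous dual of `M ⟶ E` comes from a subobject of `M` in `P`, since the
restriction of morphisms to a subobject is surjective by injectivity of `E`. -/
theorem exists_ofFunctional_eq [Injective E] (φ : space K P E M) :
    ∃ (N : Subobject M) (hN : P (N : 𝒞)) (ψ : Module.Dual K ((N : 𝒞) ⟶ E)),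
      ofFunctional K P E hN N.arrow ψ = φ := by
  obtain ⟨φ, N, i, hN, hi⟩ := φ
  have hN' : P (imageSubobject i : 𝒞) := P.prop_of_epi (factorThruImageSubobject i) hN
  let res := Linear.leftComp K E (imageSubobject i).arrow
  have hres : Function.Surjective res := fun f =>
    ⟨Injective.factorThru f (imageSubobject i).arrow, Injective.comp_factorThru _ _⟩
  have hker : LinearMap.ker res ≤ LinearMap.ker φ := fun f hf => by
    refine hi f ?_
    have hf : (imageSubobject i).arrow ≫ f = 0 := hf
    rw [← imageSubobject_arrow_comp i, Category.assoc, hf, comp_zero]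
  refine ⟨imageSubobject i, hN', (LinearMap.ker res).liftQ φ hker ∘ₗ
    (res.quotKerEquivOfSurjective hres).symm.toLinearMap, ?_⟩
  refine Subtype.ext (LinearMap.ext fun f => ?_)
  have h1 : (res.quotKerEquivOfSurjective hres).symm (res f) = (LinearMap.ker res).mkQ f := by
    rw [LinearEquiv.symm_apply_eq]
    rfl
  change (LinearMap.ker res).liftQ φ hker ((res.quotKerEquivOfSurjective hres).symm (res f)) = φ f
  rw [h1]
  rfl

variable (hP : ∀ M : 𝒞, IsLUB {N : Subobject M | P (N : 𝒞)} ⊤)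

include hP in
/-- Morphisms to `E` are separated by the continuous dual, as `M` is the sum of its subobjects in
`P`. -/
theorem eval_injective {f : M ⟶ E} (h : ∀ φ : space K P E M, φ.1 f = 0) : f = 0 := by
  have h1 : (⊤ : Subobject M) ≤ kernelSubobject f := (hP M).2 fun N hN => by
    refine le_kernelSubobject f N ((Module.forall_dual_apply_eq_zero_iff K _).1 fun ψ => ?_)
    exact h (ofFunctional K P E hN N.arrow ψ)
  have h2 : (kernelSubobject f).Factors (𝟙 M) :=
    Subobject.factors_of_le _ h1 (Subobject.top_factors _)
  simpa using (kernelSubobject_factors_iff f _).1 h2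

theorem directedOn_subobjects (M : 𝒞) :
    DirectedOn (· ≤ ·) {N : Subobject M | P (N : 𝒞)} := by
  intro N hN N' hN'
  let d := biprod.desc N.arrow N'.arrow
  refine ⟨imageSubobject d,
    P.prop_of_epi (factorThruImageSubobject d) (P.prop_biprod hN hN'), ?_, ?_⟩
  · refine Subobject.le_of_factors ?_
    simpa [d] using imageSubobject_factors_comp_self d biprod.inl
  · refine Subobject.le_of_factors ?_
    simpa [d] using imageSubobject_factors_comp_self d biprod.inr

/-- Every linear functional on the continuous dual of `M ⟶ E` is the evaluation at a morphism, which
is glued from its restrictions to the subobjects of `M` in `P`. -/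
theorem exists_eval_eq [Injective E] [IsGrothendieckAbelian.{v} 𝒞]
    (hP : ∀ M : 𝒞, IsLUB {N : Subobject M | P (N : 𝒞)} ⊤)
    (hE : ∀ M, P M → FiniteDimensional K (M ⟶ E)) (ξ : space K P E M →ₗ[K] K) :
    ∃ f : M ⟶ E, ∀ φ : space K P E M, φ.1 f = ξ φ := by
  have hg : ∀ (N : Subobject M) (hN : P (N : 𝒞)), ∃ g : (N : 𝒞) ⟶ E,
      ∀ ψ : Module.Dual K ((N : 𝒞) ⟶ E), ψ g = ξ (ofFunctional K P E hN N.arrow ψ) := by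
    intro N hN
    have := hE _ hN
    refine ⟨(Module.evalEquiv K _).symm (ξ ∘ₗ ofFunctional K P E hN N.arrow), fun ψ => ?_⟩
    rw [Module.apply_evalEquiv_symm_apply]
    rfl
  choose g hg using hg
  obtain ⟨h, hh⟩ := GrothendieckLattice.exists_glue_of_isLUB
    (D := {N : Subobject M | P (N : 𝒞)}) (Z := E)
    ⟨⊥, P.prop_of_isZero (IsZero.of_mono_eq_zero (⊥ : Subobject M).arrow Subobject.bot_arrow)⟩
    (directedOn_subobjects P M) (hP M) g (fun N N' hN hN' hle => by
      rw [← sub_eq_zero, ← Module.forall_dual_apply_eq_zero_iff K]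
      intro ψ
      rw [map_sub, hg N hN, sub_eq_zero]
      refine (hg N' hN' (ψ ∘ₗ Linear.leftComp K E (Subobject.ofLE N N' hle))).trans ?_
      congr 1
      refine Subtype.ext (LinearMap.ext fun f => ?_)
      change ψ (Subobject.ofLE N N' hle ≫ N'.arrow ≫ f) = ψ (N.arrow ≫ f)
      rw [← Category.assoc, Subobject.ofLE_arrow])
  refine ⟨inv (⊤ : Subobject M).arrow ≫ h, fun φ => ?_⟩
  obtain ⟨N, hN, ψ, rfl⟩ := exists_ofFunctional_eq K P E φ
  have h1 : Subobject.ofLE N ⊤ le_top ≫ (⊤ : Subobject M).arrow = N.arrow := Subobject.ofLE_arrow _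
  have h2 : Subobject.ofLE N ⊤ le_top ≫ h = g N hN := hh N hN
  rw [ofFunctional_apply, ← hg, ← h2, ← h1, Category.assoc, IsIso.hom_inv_id_assoc]

end ContDual

end

/-! ### Comonadicity of the continuous dual -/

section

open scoped ZeroObject

namespace ContDual

variable (K : Type v) [Field K] {𝒞 : Type u} [Category.{v} 𝒞] [Abelian 𝒞] [Linear K 𝒞]
  (P : ObjectProperty 𝒞) [P.IsSerreClass] (E : 𝒞)

variable {P E} (hP : ∀ M : 𝒞, IsLUB {N : Subobject M | P (N : 𝒞)} ⊤)

include hP in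
theorem faithful [Injective E] (hcog : ∀ M : 𝒞, ¬ IsZero M → ∃ f : M ⟶ E, f ≠ 0) :
    (functor K P E).Faithful where
  map_injective {M M'} g h hgh := by
    have h1 : ∀ f : M' ⟶ E, (g - h) ≫ f = 0 := fun f => by
      refine eval_injective K P E hP fun φ => ?_
      have := congrArg (fun ψ : space K P E M' => ψ.1 f)
        (LinearMap.congr_fun (congrArg ModuleCat.Hom.hom hgh) φ)
      change φ.1 (g ≫ f) = φ.1 (h ≫ f) at this
      rw [Preadditive.sub_comp, map_sub, this, sub_self]
    rw [← sub_eq_zero]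
    by_contra hne
    have h2 : ¬ IsZero (Abelian.image (g - h)) := fun hz => hne <| by
      rw [← Abelian.image.fac (g - h), hz.eq_of_src (Abelian.image.ι _) 0, comp_zero]
    obtain ⟨f, hf⟩ := hcog _ h2
    apply hf
    rw [← Injective.comp_factorThru f (Abelian.image.ι (g - h)),
      ← cancel_epi (Abelian.factorThruImage (g - h)), ← Category.assoc, Abelian.image.fac, h1,
      comp_zero]

/-- The duality `Hom (ω M, K) = Hom (M, E)`, natural in `M`. -/
noncomputable def dualIso [Injective E] [IsGrothendieckAbelian.{v} 𝒞]
    (hP : ∀ M : 𝒞, IsLUB {N : Subobject M | P (N : 𝒞)} ⊤)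
    (hE : ∀ M, P M → FiniteDimensional K (M ⟶ E)) :
    yoneda.obj E ≅ (functor K P E).op ⋙ yoneda.obj (ModuleCat.of K K) :=
  NatIso.ofComponents (fun M => (Equiv.ofBijective
    (fun f => (ModuleCat.ofHom (eval K P E f) : (functor K P E).obj M.unop ⟶ ModuleCat.of K K))
    ⟨fun f g h => by
      rw [← sub_eq_zero]
      refine eval_injective K P E hP fun φ => ?_
      have := LinearMap.congr_fun (congrArg ModuleCat.Hom.hom h) φ
      change φ.1 f = φ.1 g at this
      rw [map_sub, this, sub_self],
    fun ξ => by
      obtain ⟨f, hf⟩ := exists_eval_eq K P E hP hE ξ.hom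
      exact ⟨f, ModuleCat.hom_ext (LinearMap.ext hf)⟩⟩).toIso)
    (fun g => rfl)

theorem preservesColimits [Injective E] [IsGrothendieckAbelian.{v} 𝒞]
    (hP : ∀ M : 𝒞, IsLUB {N : Subobject M | P (N : 𝒞)} ⊤)
    (hE : ∀ M, P M → FiniteDimensional K (M ⟶ E)) :
    PreservesColimits (functor K P E) := by
  let Y : (ModuleCat.{v} K)ᵒᵖ ⥤ Type v := yoneda.obj (ModuleCat.of K K)
  have : Y.ReflectsIsomorphisms := ⟨fun {A B} f hf => by
    have h1 : Function.Bijective (Module.Dual.transpose (R := K) f.unop.hom) := by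
      have h2 := (isIso_iff_bijective (Y.map f)).1 hf
      let e : ∀ V : ModuleCat.{v} K, (V ⟶ ModuleCat.of K K) ≃ Module.Dual K V :=
        fun V => ModuleCat.homEquiv
      have h3 : (Module.Dual.transpose (R := K) f.unop.hom : _ → _) =
          e B.unop ∘ Y.map f ∘ (e A.unop).symm := rfl
      rw [h3]
      exact (e B.unop).bijective.comp (h2.comp (e A.unop).symm.bijective)
    have h2 := LinearMap.dualMap_bijective_iff.1 h1
    have : IsIso f.unop := (ConcreteCategory.isIso_iff_bijective f.unop).2 h2
    exact (isIso_unop_iff f).1 this⟩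
  have : ReflectsLimits Y := reflectsLimits_of_reflectsIsomorphisms
  have : PreservesLimits ((functor K P E).op ⋙ Y) :=
    preservesLimits_of_natIso (dualIso K hP hE)
  have : PreservesLimits (functor K P E).op := preservesLimits_of_reflects_of_preserves _ Y
  exact preservesColimits_of_op _

instance preservesMonomorphisms [Injective E] : (functor K P E).PreservesMonomorphisms where
  preserves {M M'} i _ := by
    rw [ModuleCat.mono_iff_injective]
    intro φ ψ h
    refine Subtype.ext (LinearMap.ext fun f => ?_)
    have := congrArg (fun χ : space K P E M' => χ.1 (Injective.factorThru f i)) h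
    change φ.1 (i ≫ Injective.factorThru f i) = ψ.1 (i ≫ Injective.factorThru f i) at this
    rwa [Injective.comp_factorThru] at this

theorem preservesFiniteLimits [Injective E] [PreservesColimits (functor K P E)] :
    PreservesFiniteLimits (functor K P E) := by
  rw [Functor.preservesFiniteLimits_iff_forall_exact_map_and_mono]
  intro S hS
  have := hS.mono_f
  refine ⟨?_, inferInstance⟩
  have h0 : PreservesFiniteColimits (functor K P E) := inferInstance
  have h := ((Functor.preservesFiniteColimits_tfae (functor K P E)).out 3 0 :).1 h0
  exact (h S hS).1

/-- The continuous dual is comonadic over vector spaces. -/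
theorem exists_isEquivalence_comparison [Injective E] [IsGrothendieckAbelian.{v} 𝒞]
    (hP : ∀ M : 𝒞, IsLUB {N : Subobject M | P (N : 𝒞)} ⊤)
    (hE : ∀ M, P M → FiniteDimensional K (M ⟶ E))
    (hcog : ∀ M : 𝒞, ¬ IsZero M → ∃ f : M ⟶ E, f ≠ 0) :
    ∃ (R : ModuleCat.{v} K ⥤ 𝒞) (adj : functor K P E ⊣ R),
      (Comonad.comparison adj).IsEquivalence := by
  have := preservesColimits K hP hE
  have := preservesFiniteLimits K (P := P) (E := E)
  have := faithful K hP hcog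
  have : (functor K P E).IsLeftAdjoint := isLeftAdjoint_of_preservesColimits_of_isSeparating
    (isSeparator_separator 𝒞) _
  let adj := Adjunction.ofIsLeftAdjoint (functor K P E)
  have : Comonad.PreservesLimitOfIsCoreflexivePair (functor K P E) := ⟨inferInstance⟩
  exact ⟨_, _, (Comonad.comonadicOfHasPreservesCoreflexiveEqualizersOfReflectsIsomorphisms
    adj).eqv⟩

/-- Every element of the comonad of the adjunction at `V` comes from a finite dimensional space
over `V`. -/
theorem exists_finiteDimensional_map_eq [Injective E]
    (hE : ∀ M, P M → FiniteDimensional K (M ⟶ E)) {R : ModuleCat.{v} K ⥤ 𝒞}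
    (adj : functor K P E ⊣ R) (V : ModuleCat.{v} K) (t : (adj.toComonad.obj V : ModuleCat.{v} K)) :
    ∃ (W : ModuleCat.{v} K) (j : W ⟶ V) (s : (adj.toComonad.obj W : ModuleCat.{v} K)),
      FiniteDimensional K W ∧ (adj.toComonad.map j).hom s = t := by
  obtain ⟨N, hN, ψ, hψ⟩ := exists_ofFunctional_eq K P E (show space K P E (R.obj V) from t)
  have := hE _ hN
  refine ⟨(functor K P E).obj N, ((adj.homEquiv _ _).symm N.arrow),
    ((functor K P E).map (adj.unit.app _)).hom (ofFunctional K P E hN (𝟙 _) ψ), ?_, ?_⟩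
  · exact inferInstanceAs (FiniteDimensional K (space K P E (N : 𝒞)))
  · have h1 : (functor K P E).map (adj.unit.app (N : 𝒞)) ≫
        (functor K P E).map (R.map ((adj.homEquiv _ _).symm N.arrow)) =
        (functor K P E).map N.arrow := by
      rw [← Functor.map_comp]
      exact congrArg _ ((adj.homEquiv_unit _ _ _).symm.trans (Equiv.apply_symm_apply _ _))
    refine (LinearMap.congr_fun (congrArg ModuleCat.Hom.hom h1) _).trans (Eq.trans ?_ hψ)
    refine Subtype.ext (LinearMap.ext fun f => ?_)
    change ψ (𝟙 _ ≫ N.arrow ≫ f) = ψ (N.arrow ≫ f)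
    rw [Category.id_comp]

end ContDual

end

/-! ### Finitary comonads on vector spaces and their coalgebras -/

namespace TensorComonad

variable {K : Type v} [Field K]

/-- A linear comonad on vector spaces such that each element of its value at `V` comes from a finite
dimensional space over `V`. Such a comonad is tensoring with a coalgebra. -/
class IsFinitary (T : Comonad (ModuleCat.{v} K)) : Prop where
  additive : T.toFunctor.Additive
  linear : letI := additive; T.toFunctor.Linear K
  exists_map_eq : ∀ (V : ModuleCat.{v} K) (t : (T.obj V : ModuleCat.{v} K)),
    ∃ (W : ModuleCat.{v} K) (j : W ⟶ V) (s : (T.obj W : ModuleCat.{v} K)),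
      FiniteDimensional K W ∧ (T.map j).hom s = t

attribute [instance] IsFinitary.additive IsFinitary.linear

/-- The coalgebra underlying a finitary comonad: its value at the ground field. -/
abbrev Coalg (T : Comonad (ModuleCat.{v} K)) : Type v :=
  (T.obj (ModuleCat.of K K) : ModuleCat.{v} K)

variable (T : Comonad (ModuleCat.{v} K))

theorem map_comp_apply {U V W : ModuleCat.{v} K} (f : U ⟶ V) (g : V ⟶ W)
    (t : (T.obj U : ModuleCat.{v} K)) :
    (T.map (f ≫ g)).hom t = (T.map g).hom ((T.map f).hom t) := by
  rw [T.map_comp]; rfl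

/-- A vector of `V` as a morphism from the ground field. -/
abbrev vec (V : ModuleCat.{v} K) (x : V) : ModuleCat.of K K ⟶ V :=
  ModuleCat.ofHom (LinearMap.toSpanSingleton K V x)

theorem vec_comp {V W : ModuleCat.{v} K} (f : V ⟶ W) (x : V) : vec V x ≫ f = vec W (f.hom x) := by
  ext
  simp [vec]

variable [IsFinitary T]

/-- The comparison map `V ⊗ T K → T V`. -/
noncomputable def comparison (V : ModuleCat.{v} K) :
    V ⊗[K] Coalg T →ₗ[K] (T.obj V : ModuleCat.{v} K) :=
  TensorProduct.lift
    { toFun := fun x => (T.map (vec V x)).hom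
      map_add' := fun x y => by
        rw [← ModuleCat.hom_add, ← T.toFunctor.map_add]
        congr 2
        ext
        simp
      map_smul' := fun r x => by
        rw [RingHom.id_apply, ← ModuleCat.hom_smul, ← T.toFunctor.map_smul]
        congr 2
        ext
        simp }

theorem comparison_tmul (V : ModuleCat.{v} K) (x : V) (c : Coalg T) :
    comparison T V (x ⊗ₜ c) = (T.map (vec V x)).hom c := rfl

theorem comparison_rTensor {V W : ModuleCat.{v} K} (f : V ⟶ W) (x : V ⊗[K] Coalg T) :
    comparison T W (f.hom.rTensor _ x) = (T.map f).hom (comparison T V x) := by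
  induction x with
  | zero => simp
  | add x y hx hy => rw [map_add, map_add, hx, hy, map_add, map_add]
  | tmul x c =>
    rw [LinearMap.rTensor_tmul, comparison_tmul, comparison_tmul, ← map_comp_apply, vec_comp]

theorem comparison_surjective (V : ModuleCat.{v} K) : Function.Surjective (comparison T V) := by
  intro t
  obtain ⟨W, j, s, _, rfl⟩ := IsFinitary.exists_map_eq V t
  let b := Module.finBasis K W
  -- the identity of `W` is the sum of the projections to the lines of a basis
  have h1 : 𝟙 W = ∑ i, ModuleCat.ofHom (b.coord i) ≫ vec W (b i) := by
    refine ModuleCat.hom_ext (LinearMap.ext fun x => ?_)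
    rw [ModuleCat.hom_sum, LinearMap.sum_apply]
    exact (b.sum_repr x).symm
  have h2 : comparison T W (∑ i, b i ⊗ₜ (T.map (ModuleCat.ofHom (b.coord i))).hom s) = s := by
    rw [map_sum]
    simp only [comparison_tmul, ← map_comp_apply]
    have h3 : (T.map (𝟙 W)).hom s = s := by rw [T.map_id]; rfl
    rw [h1, T.toFunctor.map_sum, ModuleCat.hom_sum, LinearMap.sum_apply] at h3
    exact h3
  refine ⟨j.hom.rTensor _ (∑ i, b i ⊗ₜ (T.map (ModuleCat.ofHom (b.coord i))).hom s), ?_⟩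
  rw [comparison_rTensor, h2]

theorem comparison_injective (V : ModuleCat.{v} K) : Function.Injective (comparison T V) := by
  classical
  rw [injective_iff_map_eq_zero]
  intro x hx
  let b := Module.Basis.ofVectorSpace K V
  let e := TensorProduct.equivFinsuppOfBasisLeft (M := V) (N := Coalg T) b
  -- the coordinate functionals of a basis recover the coefficients of `x`
  have h1 : ∀ (x : V ⊗[K] Coalg T) i,
      e x i = (T.map (ModuleCat.ofHom (b.coord i))).hom (comparison T V x) := by
    intro x i
    induction x with
    | zero => simp
    | add x y hx hy => simp [hx, hy]
    | tmul x c =>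
      rw [comparison_tmul, ← map_comp_apply, vec_comp]
      have h2 : vec (ModuleCat.of K K) ((ModuleCat.ofHom (b.coord i)).hom x) =
          b.repr x i • 𝟙 (ModuleCat.of K K) := by
        ext
        simp [vec]
      rw [h2, T.toFunctor.map_smul, T.toFunctor.map_id]
      exact TensorProduct.equivFinsuppOfBasisLeft_apply_tmul_apply b x c i
  refine e.map_eq_zero_iff.1 (Finsupp.ext fun i => ?_)
  rw [h1, hx, map_zero]
  rfl

/-- The isomorphism `V ⊗ T K ≃ T V`. -/
noncomputable def equiv (V : ModuleCat.{v} K) :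
    V ⊗[K] Coalg T ≃ₗ[K] (T.obj V : ModuleCat.{v} K) :=
  LinearEquiv.ofBijective (comparison T V) ⟨comparison_injective T V, comparison_surjective T V⟩

theorem equiv_rTensor {V W : ModuleCat.{v} K} (f : V ⟶ W) (x : V ⊗[K] Coalg T) :
    equiv T W (f.hom.rTensor _ x) = (T.map f).hom (equiv T V x) := comparison_rTensor T f x

/-- The counit of the coalgebra of a finitary comonad. -/
noncomputable def counit : Coalg T →ₗ[K] K := (T.ε.app (ModuleCat.of K K)).hom

/-- The comultiplication of the coalgebra of a finitary comonad. -/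
noncomputable def comul : Coalg T →ₗ[K] Coalg T ⊗[K] Coalg T :=
  (equiv T (T.obj (ModuleCat.of K K))).symm.toLinearMap ∘ₗ (T.δ.app (ModuleCat.of K K)).hom

theorem equiv_comul (c : Coalg T) :
    equiv T (T.obj (ModuleCat.of K K)) (comul T c) = (T.δ.app (ModuleCat.of K K)).hom c :=
  LinearEquiv.apply_symm_apply _ _

theorem ε_equiv (V : ModuleCat.{v} K) (x : V ⊗[K] Coalg T) :
    (T.ε.app V).hom (equiv T V x) = TensorProduct.rid K V ((counit T).lTensor V x) := by
  induction x with
  | zero => simp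
  | add x y hx hy => rw [map_add, map_add, hx, hy, map_add, map_add]
  | tmul x c =>
    have h := LinearMap.congr_fun (congrArg ModuleCat.Hom.hom (T.ε.naturality (vec V x))) c
    rw [LinearMap.lTensor_tmul, TensorProduct.rid_tmul]
    exact h

/-- The comultiplication of the comonad on `V ⊗ T K`, in terms of the comultiplication of `T K`. -/
theorem δ_equiv (V : ModuleCat.{v} K) (x : V ⊗[K] Coalg T) :
    (T.δ.app V).hom (equiv T V x) = equiv T (T.obj V) ((equiv T V).toLinearMap.rTensor _
      ((TensorProduct.assoc K V (Coalg T) (Coalg T)).symm ((comul T).lTensor V x))) := by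
  induction x with
  | zero => simp
  | add x y hx hy => simp only [map_add, hx, hy]
  | tmul x c =>
    have h := LinearMap.congr_fun (congrArg ModuleCat.Hom.hom (T.δ.naturality (vec V x))) c
    have h1 : ∀ y : Coalg T ⊗[K] Coalg T, (equiv T V).toLinearMap.rTensor _
        ((TensorProduct.assoc K V (Coalg T) (Coalg T)).symm (x ⊗ₜ y)) =
        (T.map (vec V x)).hom.rTensor _ y := by
      intro y
      induction y with
      | zero => simp
      | add y z hy hz => simp only [TensorProduct.tmul_add, map_add, hy, hz]
      | tmul y z => rfl
    rw [LinearMap.lTensor_tmul, h1, equiv_rTensor, equiv_comul]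
    exact h

/-- The map used to test equality in `V ⊗ T K ⊗ T K`. -/
theorem equiv_assoc_injective (V : ModuleCat.{v} K) :
    Function.Injective fun x => equiv T (T.obj V) ((equiv T V).toLinearMap.rTensor (Coalg T)
      ((TensorProduct.assoc K V (Coalg T) (Coalg T)).symm x)) :=
  (equiv T (T.obj V)).injective.comp (((equiv T V).rTensor (Coalg T)).injective.comp
    (TensorProduct.assoc K V (Coalg T) (Coalg T)).symm.injective)

noncomputable instance : Coalgebra K (Coalg T) where
  comul := comul T
  counit := counit T
  coassoc := by
    refine LinearMap.ext fun c => equiv_assoc_injective T (T.obj (ModuleCat.of K K)) ?_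
    simp only [LinearMap.comp_apply, LinearEquiv.coe_coe, LinearEquiv.symm_apply_apply]
    rw [← δ_equiv, equiv_comul, ← LinearMap.comp_apply, ← LinearMap.rTensor_comp]
    have h1 : (equiv T (T.obj (ModuleCat.of K K))).toLinearMap ∘ₗ comul T =
        (T.δ.app (ModuleCat.of K K)).hom := LinearMap.ext (equiv_comul T)
    rw [h1, equiv_rTensor, equiv_comul]
    exact LinearMap.congr_fun (congrArg ModuleCat.Hom.hom (T.coassoc (ModuleCat.of K K))) c
  rTensor_counit_comp_comul := by
    refine LinearMap.ext fun c => (equiv T (ModuleCat.of K K)).injective ?_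
    have h1 := equiv_rTensor T (T.ε.app (ModuleCat.of K K)) (comul T c)
    rw [equiv_comul] at h1
    refine h1.trans ((LinearMap.congr_fun (congrArg ModuleCat.Hom.hom
      (T.right_counit (ModuleCat.of K K))) c).trans ?_)
    have h2 : vec (ModuleCat.of K K) (1 : K) = 𝟙 _ := by
      ext
      simp [vec]
    change c = (T.map (vec (ModuleCat.of K K) (1 : K))).hom c
    rw [h2, T.map_id]
    rfl
  lTensor_counit_comp_comul := by
    refine LinearMap.ext fun c => (TensorProduct.rid K (Coalg T)).injective ?_
    have h1 := ε_equiv T (T.obj (ModuleCat.of K K)) (comul T c)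
    rw [equiv_comul] at h1
    refine h1.symm.trans ((LinearMap.congr_fun (congrArg ModuleCat.Hom.hom
      (T.left_counit (ModuleCat.of K K))) c).trans ?_)
    change c = TensorProduct.rid K (Coalg T) (c ⊗ₜ[K] (1 : K))
    rw [TensorProduct.rid_tmul, one_smul]

end TensorComonad

/-! ### Coalgebras over a finitary comonad are comodules -/

namespace TensorComonad

variable {K : Type v} [Field K] (T : Comonad (ModuleCat.{v} K)) [IsFinitary T]

/-- The coaction on a coalgebra of the comonad. -/
noncomputable def coact (A : T.Coalgebra) : A.A →ₗ[K] A.A ⊗[K] Coalg T :=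
  (equiv T A.A).symm.toLinearMap ∘ₗ A.a.hom

theorem equiv_coact (A : T.Coalgebra) (m : A.A) : equiv T A.A (coact T A m) = A.a.hom m :=
  LinearEquiv.apply_symm_apply _ _

theorem equiv_comp_coact (A : T.Coalgebra) : (equiv T A.A).toLinearMap ∘ₗ coact T A = A.a.hom :=
  LinearMap.ext (equiv_coact T A)

/-- A coalgebra over the comonad is a comodule over the coalgebra of the comonad. -/
noncomputable def toComod (A : T.Coalgebra) : ComodCat.{v} K (Coalg T) where
  carrier := A.A
  comodule :=
    { coact := coact T A
      coassoc := by
        refine LinearMap.ext fun m => equiv_assoc_injective T A.A ?_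
        simp only [LinearMap.comp_apply, LinearEquiv.coe_coe, LinearEquiv.symm_apply_apply]
        change _ = equiv T (T.obj A.A) ((equiv T A.A).toLinearMap.rTensor (Coalg T)
          ((TensorProduct.assoc K A.A (Coalg T) (Coalg T)).symm
            ((comul T).lTensor A.A (coact T A m))))
        rw [← δ_equiv, equiv_coact, ← LinearMap.comp_apply, ← LinearMap.rTensor_comp,
          equiv_comp_coact, equiv_rTensor, equiv_coact]
        exact (LinearMap.congr_fun (congrArg ModuleCat.Hom.hom A.coassoc) m).symm
      counit := by
        refine LinearMap.ext fun m => (ε_equiv T A.A (coact T A m)).symm.trans ?_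
        rw [equiv_coact]
        exact LinearMap.congr_fun (congrArg ModuleCat.Hom.hom A.counit) m }

/-- Coalgebras over the comonad as comodules. -/
noncomputable def toComodFunctor : T.Coalgebra ⥤ ComodCat.{v} K (Coalg T) where
  obj A := toComod T A
  map {A B} f :=
    { lin := f.f.hom
      comm := by
        refine LinearMap.ext fun m => (equiv T B.A).injective ?_
        refine (equiv_coact T B _).trans (Eq.trans ?_ (equiv_rTensor T f.f (coact T A m)).symm)
        exact ((congrArg (T.map f.f).hom (equiv_coact T A m)).trans
          (LinearMap.congr_fun (congrArg ModuleCat.Hom.hom f.h) m)).symm }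
  map_id _ := rfl
  map_comp _ _ := rfl

instance : (toComodFunctor T).Faithful where
  map_injective h := Comonad.Coalgebra.Hom.ext
    (ModuleCat.hom_ext (congrArg ComodCat.Hom.lin h))

instance : (toComodFunctor T).Full where
  map_surjective {A B} f := by
    refine ⟨⟨ModuleCat.ofHom (X := A.A) (Y := B.A) f.lin, ?_⟩, rfl⟩
    refine ModuleCat.hom_ext (LinearMap.ext fun m => ?_)
    have h := congrArg (equiv T B.A) (LinearMap.congr_fun f.comm m)
    have h1 := equiv_rTensor T (ModuleCat.ofHom (X := A.A) (Y := B.A) f.lin) (coact T A m)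
    exact (congrArg _ (equiv_coact T A m)).symm.trans
      (h1.symm.trans (h.symm.trans (equiv_coact T B _)))

/-- The coalgebra over the comonad given by a comodule. -/
noncomputable def ofComod (M : ComodCat.{v} K (Coalg T)) : T.Coalgebra where
  A := ModuleCat.of K M
  a := ModuleCat.ofHom ((equiv T (ModuleCat.of K M)).toLinearMap ∘ₗ M.ρ)
  counit := by
    refine ModuleCat.hom_ext (LinearMap.ext fun m => ?_)
    exact (ε_equiv T (ModuleCat.of K M) (M.ρ m)).trans (M.ρ_counit m)
  coassoc := by
    refine ModuleCat.hom_ext (LinearMap.ext fun m => ?_)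
    refine (δ_equiv T (ModuleCat.of K M) (M.ρ m)).trans ?_
    have h := equiv_rTensor T
      (ModuleCat.ofHom ((equiv T (ModuleCat.of K M)).toLinearMap ∘ₗ M.ρ)) (M.ρ m)
    refine Eq.trans ?_ h
    have h1 := M.ρ_coassoc m
    change _ = (comul T).lTensor (ModuleCat.of K M) (M.ρ m) at h1
    rw [← h1]
    change equiv T _ ((equiv T (ModuleCat.of K M)).toLinearMap.rTensor (Coalg T)
      ((TensorProduct.assoc K M (Coalg T) (Coalg T)).symm
        (TensorProduct.assoc K M (Coalg T) (Coalg T) _))) = _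
    rw [LinearEquiv.symm_apply_apply]
    change _ = equiv T _ (((equiv T (ModuleCat.of K M)).toLinearMap ∘ₗ M.ρ).rTensor _ _)
    rw [LinearMap.rTensor_comp]
    rfl

theorem ρ_toComod_ofComod (M : ComodCat.{v} K (Coalg T)) : coact T (ofComod T M) = M.ρ :=
  LinearMap.ext fun m => LinearEquiv.symm_apply_apply (equiv T (ModuleCat.of K M)) (M.ρ m)

instance : (toComodFunctor T).EssSurj where
  mem_essImage M := by
    have h : (toComod T (ofComod T M)).ρ = M.ρ := ρ_toComod_ofComod T M
    refine ⟨ofComod T M, ⟨{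
      hom := ⟨LinearMap.id, ?_⟩
      inv := ⟨LinearMap.id, ?_⟩
      hom_inv_id := rfl
      inv_hom_id := rfl }⟩⟩
    · refine LinearMap.ext fun m => ?_
      refine Eq.trans (LinearMap.congr_fun h m).symm ?_
      exact (LinearMap.congr_fun (LinearMap.rTensor_id (R := K) (Coalg T) M) _).symm
    · refine LinearMap.ext fun m => ?_
      refine Eq.trans (LinearMap.congr_fun h m) ?_
      exact (LinearMap.congr_fun (LinearMap.rTensor_id (R := K) (Coalg T) M) _).symm

instance : (toComodFunctor T).IsEquivalence where

end TensorComonad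

section

variable {K : Type v} [Field K] {𝒞 : Type u} [Category.{v} 𝒞] [Abelian 𝒞] [Linear K 𝒞]

/-- The right adjoint of a linear functor is linear. -/
theorem CategoryTheory.Adjunction.right_adjoint_linear {𝒟 : Type*} [Category* 𝒟] [Preadditive 𝒟]
    [Linear K 𝒟] {L : 𝒞 ⥤ 𝒟} {R : 𝒟 ⥤ 𝒞} (adj : L ⊣ R) [L.Additive] [R.Additive]
    [L.Linear K] : R.Linear K where
  map_smul {X Y} f r := by
    refine (adj.homEquiv _ _).symm.injective ?_
    rw [adj.homEquiv_counit, adj.homEquiv_counit, L.map_smul, Linear.smul_comp,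
      adj.counit_naturality, adj.counit_naturality, Linear.comp_smul]

/-- A Grothendieck category with an injective cogenerator `E`, each of whose objects is the sum of
subobjects from a Serre class of objects with finite dimensional morphism spaces to `E`, is the
category of comodules over a coalgebra. -/
theorem exists_coalgebra_equivalence [IsGrothendieckAbelian.{v} 𝒞] {P : ObjectProperty 𝒞}
    [P.IsSerreClass] {E : 𝒞} [Injective E]
    (hP : ∀ M : 𝒞, IsLUB {N : Subobject M | P (N : 𝒞)} ⊤)
    (hE : ∀ M, P M → FiniteDimensional K (M ⟶ E))
    (hcog : ∀ M : 𝒞, ¬ IsZero M → ∃ f : M ⟶ E, f ≠ 0) :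
    ∃ (C : Type v) (_ : AddCommGroup C) (_ : Module K C) (_ : Coalgebra K C)
      (e : 𝒞 ≌ ComodCat.{v} K C), e.functor.Additive ∧ e.functor.Linear K := by
  obtain ⟨R, adj, hadj⟩ := ContDual.exists_isEquivalence_comparison K hP hE hcog
  have : R.Additive := adj.right_adjoint_additive
  have : R.Linear K := adj.right_adjoint_linear
  have hT : TensorComonad.IsFinitary adj.toComonad :=
    { additive := inferInstanceAs (R ⋙ ContDual.functor K P E).Additive
      linear := inferInstanceAs ((R ⋙ ContDual.functor K P E).Linear K)
      exists_map_eq := ContDual.exists_finiteDimensional_map_eq K hE adj }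
  let F := Comonad.comparison adj ⋙ TensorComonad.toComodFunctor adj.toComonad
  have hF : ∀ {M N : 𝒞} (f : M ⟶ N), (F.map f).lin = ((ContDual.functor K P E).map f).hom :=
    fun f => rfl
  have hadd : F.Additive := ⟨fun {M N f g} => by
    refine ComodCat.hom_ext ?_
    rw [hF, Functor.map_add]
    rfl⟩
  exact ⟨TensorComonad.Coalg adj.toComonad, inferInstance, inferInstance, inferInstance,
    F.asEquivalence, hadd, ⟨fun {M N} f r => by
      refine ComodCat.hom_ext ?_
      change (F.map (r • f)).lin = r • (F.map f).lin
      rw [hF, Functor.map_smul]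
      rfl⟩⟩

end

/-! ### Subcomodules and local finiteness -/

namespace ComodCat

variable {K : Type*} [Field K] {C : Type*} [AddCommGroup C] [Module K C] [Coalgebra K C]

/-- A subspace is a subcomodule if the coaction maps it to its tensor product with the coalgebra. -/
def IsSubcomodule (M : ComodCat.{w} K C) (V : Submodule K M) : Prop :=
  ∀ x ∈ V, M.ρ x ∈ LinearMap.range (V.subtype.rTensor C)

theorem rTensor_injective {V W : Type*} [AddCommGroup V] [Module K V] [AddCommGroup W] [Module K W]
    {i : V →ₗ[K] W} (hi : Function.Injective i) (D : Type*) [AddCommGroup D] [Module K D] :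
    Function.Injective (i.rTensor D) :=
  Module.Flat.rTensor_preserves_injective_linearMap i hi

theorem exists_restrict_coact {M : ComodCat.{w} K C} {V : Submodule K M} (h : M.IsSubcomodule V) :
    ∃ σ : V →ₗ[K] V ⊗[K] C, V.subtype.rTensor C ∘ₗ σ = M.ρ ∘ₗ V.subtype := by
  let e := LinearEquiv.ofInjective _ (rTensor_injective V.injective_subtype C)
  refine ⟨e.symm.toLinearMap ∘ₗ (M.ρ ∘ₗ V.subtype).codRestrict _ fun x => h x.1 x.2, ?_⟩
  refine LinearMap.ext fun x => ?_
  exact congrArg Subtype.val (e.apply_symm_apply _)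

/-- A subcomodule as a comodule. -/
noncomputable def sub (M : ComodCat.{w} K C) (V : Submodule K M) (h : M.IsSubcomodule V) :
    ComodCat.{w} K C where
  carrier := V
  comodule :=
    { coact := (exists_restrict_coact h).choose
      coassoc := by
        have hσ := fun x => LinearMap.congr_fun (exists_restrict_coact h).choose_spec x
        have hσ' := (exists_restrict_coact h).choose_spec
        generalize (exists_restrict_coact h).choose = σ at hσ hσ'
        refine LinearMap.ext fun x => rTensor_injective V.injective_subtype (C ⊗[K] C) ?_
        simp only [LinearMap.comp_apply, LinearEquiv.coe_coe] at hσ ⊢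
        rw [← assoc_rTensor_rTensor, ← lTensor_rTensor, hσ, ← ρ_coassoc,
          ← LinearMap.comp_apply (LinearMap.rTensor C (LinearMap.rTensor C _)),
          ← LinearMap.rTensor_comp, hσ', LinearMap.rTensor_comp, LinearMap.comp_apply, hσ]
      counit := by
        have hσ := fun x => LinearMap.congr_fun (exists_restrict_coact h).choose_spec x
        generalize (exists_restrict_coact h).choose = σ at hσ
        refine LinearMap.ext fun x => V.injective_subtype ?_
        simp only [LinearMap.comp_apply, LinearEquiv.coe_coe] at hσ ⊢
        rw [← rid_rTensor, ← lTensor_rTensor, hσ, ρ_counit]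
        rfl }

/-- The inclusion of a subcomodule. -/
noncomputable def subι (M : ComodCat.{w} K C) (V : Submodule K M) (h : M.IsSubcomodule V) :
    M.sub V h ⟶ M where
  lin := V.subtype
  comm := (exists_restrict_coact h).choose_spec.symm

variable {M N : ComodCat.{w} K C} (f : M ⟶ N)

theorem hom_comm_apply (x : M) : N.ρ (f.lin x) = f.lin.rTensor C (M.ρ x) :=
  LinearMap.congr_fun f.comm x

theorem isSubcomodule_ker : M.IsSubcomodule (LinearMap.ker f.lin) := by
  intro x hx
  have h : Function.Exact (LinearMap.ker f.lin).subtype f.lin := f.lin.exact_subtype_ker_map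
  refine (Module.Flat.rTensor_exact C h (M.ρ x)).1 ?_
  rw [← hom_comm_apply, LinearMap.mem_ker.1 hx, map_zero]

theorem isSubcomodule_range : N.IsSubcomodule (LinearMap.range f.lin) := by
  rintro _ ⟨x, rfl⟩
  refine ⟨f.lin.rangeRestrict.rTensor C (M.ρ x), ?_⟩
  rw [hom_comm_apply, ← LinearMap.comp_apply, ← LinearMap.rTensor_comp]
  rfl

theorem mono_of_injective (h : Function.Injective f.lin) : Mono f :=
  ⟨fun _ _ hab => hom_ext (LinearMap.ext fun x =>
    h (LinearMap.congr_fun (congrArg Hom.lin hab) x))⟩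

theorem epi_of_surjective (h : Function.Surjective f.lin) : Epi f :=
  ⟨fun a b hab => hom_ext (LinearMap.ext fun x => by
    obtain ⟨x, rfl⟩ := h x
    exact LinearMap.congr_fun (congrArg Hom.lin hab) x)⟩

theorem injective_of_mono [Mono f] : Function.Injective f.lin := by
  have h : M.subι _ (isSubcomodule_ker f) = 0 := by
    rw [← cancel_mono f, Limits.zero_comp]
    exact hom_ext (LinearMap.ext fun x => x.2)
  refine (injective_iff_map_eq_zero _).2 fun x hx => ?_
  exact LinearMap.congr_fun (congrArg Hom.lin h) (⟨x, hx⟩ : LinearMap.ker f.lin)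

theorem mono_subι (V : Submodule K M) (h : M.IsSubcomodule V) : Mono (M.subι V h) :=
  mono_of_injective _ V.injective_subtype

theorem bijective_of_isIso [IsIso f] : Function.Bijective f.lin := by
  refine ⟨injective_of_mono f, fun x => ⟨(inv f).lin x, ?_⟩⟩
  exact LinearMap.congr_fun (congrArg Hom.lin (IsIso.inv_hom_id f)) x

/-- The factorization of a morphism through its image. -/
noncomputable def toImage : M ⟶ N.sub _ (isSubcomodule_range f) where
  lin := f.lin.rangeRestrict
  comm := by
    refine LinearMap.ext fun x =>
      rTensor_injective (LinearMap.range f.lin).injective_subtype C ?_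
    have h1 := hom_comm_apply (N.subι _ (isSubcomodule_range f)) (f.lin.rangeRestrict x)
    exact h1.symm.trans ((hom_comm_apply f x).trans (LinearMap.congr_fun
      (LinearMap.rTensor_comp C (LinearMap.range f.lin).subtype f.lin.rangeRestrict) (M.ρ x)))

theorem toImage_subι : toImage f ≫ N.subι _ (isSubcomodule_range f) = f := rfl

theorem surjective_of_epi [Balanced (ComodCat.{w} K C)] [Epi f] : Function.Surjective f.lin := by
  have := mono_subι _ (isSubcomodule_range f)
  have : Epi (N.subι _ (isSubcomodule_range f)) :=
    have : Epi (toImage f ≫ N.subι _ (isSubcomodule_range f)) := by rwa [toImage_subι]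
    epi_of_epi (toImage f) _
  have := isIso_of_mono_of_epi (N.subι _ (isSubcomodule_range f))
  intro x
  obtain ⟨y, rfl⟩ := (bijective_of_isIso (N.subι _ (isSubcomodule_range f))).2 x
  exact y.2

/-- The fundamental theorem of comodules: every element lies in a finite dimensional subcomodule. -/
theorem exists_finiteDimensional_subcomodule (x : M) :
    ∃ V : Submodule K M, M.IsSubcomodule V ∧ FiniteDimensional K V ∧ x ∈ V := by
  classical
  let b := Module.Basis.ofVectorSpace K C
  let e := TensorProduct.equivFinsuppOfBasisRight (M := M) (N := C) b
  -- the span of the coefficients of the coaction at `x`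
  let V := Submodule.span K (Set.range (e (M.ρ x)))
  have hmem : M.ρ x ∈ LinearMap.range (V.subtype.rTensor C) := by
    rw [← e.symm_apply_apply (M.ρ x), TensorProduct.equivFinsuppOfBasisRight_symm_apply]
    exact Submodule.sum_mem _ fun i _ =>
      ⟨⟨_, Submodule.subset_span ⟨i, rfl⟩⟩ ⊗ₜ b i, rfl⟩
  obtain ⟨y, hy⟩ := hmem
  refine ⟨V, ?_, ?_, ?_⟩
  · have hV : V ≤ (LinearMap.range (V.subtype.rTensor C)).comap M.ρ := by
      refine Submodule.span_le.2 ?_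
      rintro _ ⟨i, rfl⟩
      -- coassociativity at the `i`-th coefficient, where `ψ` contracts `Δ` with `b.coord i`
      let ψ : C →ₗ[K] C := (TensorProduct.rid K C).toLinearMap ∘ₗ (b.coord i).lTensor C ∘ₗ
        Coalgebra.comul
      have h1 : ∀ z : M ⊗[K] C, e z i = TensorProduct.rid K M ((b.coord i).lTensor M z) := by
        intro z
        induction z with
        | zero => simp
        | add z z' h h' => simp only [map_add, Finsupp.add_apply, h, h']
        | tmul m c => exact TensorProduct.equivFinsuppOfBasisRight_apply_tmul_apply b m c i
      have h2 : ∀ z : M ⊗[K] C, M.ρ (TensorProduct.rid K M ((b.coord i).lTensor M z)) =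
          TensorProduct.rid K _ ((b.coord i).lTensor _ (M.ρ.rTensor C z)) := by
        intro z
        rw [lTensor_rTensor, rid_rTensor]
      have h3 : ∀ z : (M ⊗[K] C) ⊗[K] C,
          TensorProduct.rid K _ ((b.coord i).lTensor _ z) =
          ((TensorProduct.rid K C).toLinearMap ∘ₗ (b.coord i).lTensor C).lTensor M
            (TensorProduct.assoc K M C C z) := by
        intro z
        refine LinearMap.congr_fun (f := (TensorProduct.rid K (M ⊗[K] C)).toLinearMap ∘ₗ
          (b.coord i).lTensor _) (g := ((TensorProduct.rid K C).toLinearMap ∘ₗ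
          (b.coord i).lTensor C).lTensor M ∘ₗ
          (TensorProduct.assoc K M C C).toLinearMap) ?_ z
        ext; simp
      refine ⟨ψ.lTensor V y, ?_⟩
      rw [← lTensor_rTensor, hy, h1, h2, h3, ρ_coassoc]
      exact LinearMap.congr_fun (LinearMap.lTensor_comp M ((TensorProduct.rid K C).toLinearMap ∘ₗ
        (b.coord i).lTensor C) (Coalgebra.comul (R := K) (A := C))) (M.ρ x)
    exact fun z hz => hV hz
  · have h : Set.range (e (M.ρ x)) ⊆ insert 0 (e (M.ρ x) '' (e (M.ρ x)).support) := by
      rintro _ ⟨i, rfl⟩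
      by_cases hi : e (M.ρ x) i = 0
      · exact Or.inl hi
      · exact Or.inr ⟨i, Finsupp.mem_support_iff.2 hi, rfl⟩
    exact FiniteDimensional.span_of_finite K
      (((Finset.finite_toSet _).image _ |>.insert 0).subset h)
  · rw [← M.ρ_counit x, ← hy, lTensor_rTensor, rid_rTensor]
    exact Submodule.coe_mem _

end ComodCat

/-! ### Finite dimensional comodules and semiperfectness -/

section

open scoped ZeroObject

open ComodCat

namespace OrderedGrothendieck

variable {K : Type v} [Field K] {𝒞 : Type u} [Category.{v} 𝒞] [Abelian 𝒞]
  {C : Type v} [AddCommGroup C] [Module K C] [Coalgebra K C]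

/-- The objects of `𝒞` whose image under `F` is a finite dimensional comodule. -/
def FiniteDimensionalImage (F : 𝒞 ⥤ ComodCat.{v} K C) : ObjectProperty 𝒞 :=
  fun M => FiniteDimensional K (F.obj M)

theorem balanced_of_isEquivalence (F : 𝒞 ⥤ ComodCat.{v} K C) [F.IsEquivalence] :
    Balanced (ComodCat.{v} K C) where
  isIso_of_mono_of_epi f _ _ := by
    have := isIso_of_mono_of_epi (F.inv.map f)
    exact isIso_of_reflects_iso f F.inv

variable (F : 𝒞 ⥤ ComodCat.{v} K C) [F.IsEquivalence]

/-- A subcomodule of `F.obj M` comes from a subobject of `M`. -/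
theorem exists_map_eq_subι {M : 𝒞} (V : Submodule K (F.obj M)) (hV : (F.obj M).IsSubcomodule V) :
    ∃ (N : 𝒞) (i : N ⟶ M) (e : F.obj N ≅ (F.obj M).sub V hV), Mono i ∧
      F.map i = e.hom ≫ (F.obj M).subι V hV := by
  let e := F.objObjPreimageIso ((F.obj M).sub V hV)
  refine ⟨_, F.preimage (e.hom ≫ (F.obj M).subι V hV), e, ?_, F.map_preimage _⟩
  have := mono_subι V hV
  have : Mono (F.map (F.preimage (e.hom ≫ (F.obj M).subι V hV))) := by
    rw [F.map_preimage]
    infer_instance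
  exact F.mono_of_mono_map this

variable [F.Additive]

instance : (FiniteDimensionalImage F).IsSerreClass where
  exists_zero := by
    refine ⟨0, isZero_zero _, ?_⟩
    have h : IsZero (F.obj 0) := F.map_isZero (isZero_zero 𝒞)
    have : Subsingleton (F.obj 0) := subsingleton_of_forall_eq 0 fun x =>
      LinearMap.congr_fun (congrArg Hom.lin (h.eq_of_src (𝟙 (F.obj 0)) 0)) x
    exact Module.Finite.of_finite
  prop_of_mono i _ h := by
    have : FiniteDimensional K (F.obj _) := h
    exact FiniteDimensional.of_injective _ (injective_of_mono (F.map i))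
  prop_of_epi p _ h := by
    have : FiniteDimensional K (F.obj _) := h
    have := balanced_of_isEquivalence F
    exact Module.Finite.of_surjective _ (surjective_of_epi (F.map p))
  prop_X₂_of_shortExact {S} hS h₁ h₃ := by
    have : FiniteDimensional K (F.obj S.X₁) := h₁
    have : FiniteDimensional K (F.obj S.X₃) := h₃
    have := hS.mono_f
    obtain ⟨N, i, e, -, hi⟩ := exists_map_eq_subι F _ (isSubcomodule_ker (F.map S.g))
    have h0 : i ≫ S.g = 0 := F.map_injective <| by
      have h : (F.obj S.X₂).subι _ (isSubcomodule_ker (F.map S.g)) ≫ F.map S.g = 0 :=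
        hom_ext (LinearMap.ext fun x => x.2)
      rw [F.map_comp, hi, F.map_zero, Category.assoc, h, comp_zero]
    have h1 : e.inv ≫ F.map (hS.exact.lift i h0) ≫ F.map S.f =
        (F.obj S.X₂).subι _ (isSubcomodule_ker (F.map S.g)) := by
      rw [← F.map_comp, hS.exact.lift_f, hi, Iso.inv_hom_id_assoc]
    have hle : LinearMap.ker (F.map S.g).lin ≤ LinearMap.range (F.map S.f).lin := fun x hx =>
      ⟨_, LinearMap.congr_fun (congrArg Hom.lin h1) (⟨x, hx⟩ : LinearMap.ker (F.map S.g).lin)⟩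
    have : FiniteDimensional K (LinearMap.ker (F.map S.g).lin) :=
      Submodule.finiteDimensional_of_le hle
    have : FiniteDimensional K (F.obj S.X₂ ⧸ LinearMap.ker (F.map S.g).lin) :=
      Module.Finite.equiv (F.map S.g).lin.quotKerEquivRange.symm
    exact Module.Finite.of_submodule_quotient (LinearMap.ker (F.map S.g).lin)

/-- Simple comodules are finite dimensional. -/
theorem finiteDimensionalImage_of_simple (S : 𝒞) (hS : Simple S) : FiniteDimensionalImage F S := by
  obtain ⟨x, hx⟩ : ∃ x : F.obj S, x ≠ 0 := by
    by_contra! h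
    refine id_nonzero S (F.map_injective (hom_ext (LinearMap.ext fun x => ?_)))
    rw [h x, map_zero, map_zero]
  obtain ⟨V, hV, hfin, hxV⟩ := exists_finiteDimensional_subcomodule x
  obtain ⟨N, i, e, _, hi⟩ := exists_map_eq_subι F V hV
  have hi0 : i ≠ 0 := by
    rintro rfl
    have h : (F.obj S).subι V hV = 0 := by
      rw [← cancel_epi e.hom, ← hi, F.map_zero, comp_zero]
    exact hx (LinearMap.congr_fun (congrArg Hom.lin h) (⟨x, hxV⟩ : V))
  have := isIso_of_mono_of_nonzero hi0
  have : IsIso ((F.obj S).subι V hV) := by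
    have : IsIso (e.hom ≫ (F.obj S).subι V hV) := by
      rw [← hi]
      infer_instance
    exact IsIso.of_isIso_comp_left e.hom _
  have : FiniteDimensional K ((F.obj S).sub V hV) := hfin
  exact Module.Finite.of_surjective _ (bijective_of_isIso ((F.obj S).subι V hV)).2

variable {I : Type w} [PartialOrder I] (G : OrderedGrothendieckStructure 𝒞 I)

/-- An equivalence with a category of comodules identifies `G.fin` with the finite dimensional
comodules. -/
theorem fin_iff_finiteDimensional (M : 𝒞) : G.fin M ↔ FiniteDimensional K (F.obj M) := by
  refine ⟨fun hM => fin_le_of_simple G (FiniteDimensionalImage F)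
    (finiteDimensionalImage_of_simple F) hM, fun hM => ?_⟩
  have hinj : ∀ {A B : 𝒞} (i : A ⟶ B) [Mono i], Function.Injective (F.map i).lin :=
    fun i _ => injective_of_mono (F.map i)
  let d : {N : Subobject M // G.fin (N : 𝒞)} → ℕ := fun N => Module.finrank K (F.obj (N.1 : 𝒞))
  -- a subobject in `G.fin` whose dimension is as large as possible contains all the others
  have hbdd : BddAbove (Set.range d) := by
    refine ⟨Module.finrank K (F.obj M), ?_⟩
    rintro _ ⟨N, rfl⟩
    exact LinearMap.finrank_le_finrank_of_injective (hinj N.1.arrow)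
  have hne : (Set.range d).Nonempty :=
    ⟨_, ⟨⟨⊥, G.fin.prop_of_iso Subobject.botCoeIsoZero.symm G.fin.prop_zero⟩, rfl⟩⟩
  obtain ⟨N, hN⟩ := Nat.sSup_mem hne hbdd
  have hmax : ∀ N' : Subobject M, G.fin (N' : 𝒞) → N' ≤ N.1 := by
    intro N' hN'
    obtain ⟨U, hU, hNU, hN'U⟩ := ContDual.directedOn_subobjects (P := G.fin) M N.1 N.2 N' hN'
    have : FiniteDimensional K (F.obj (U : 𝒞)) :=
      FiniteDimensional.of_injective _ (hinj U.arrow)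
    have h1 : d ⟨U, hU⟩ ≤ d N := hN ▸ le_csSup hbdd ⟨_, rfl⟩
    have : FiniteDimensional K (F.obj (N.1 : 𝒞)) :=
      FiniteDimensional.of_injective _ (hinj N.1.arrow)
    have h2 : d N = d ⟨U, hU⟩ :=
      (LinearMap.finrank_le_finrank_of_injective (hinj (Subobject.ofLE _ _ hNU))).antisymm h1
    have h3 := (LinearMap.injective_iff_surjective_of_finrank_eq_finrank h2).1
      (hinj (Subobject.ofLE _ _ hNU))
    have : Epi (Subobject.ofLE _ _ hNU) := F.epi_of_epi_map (epi_of_surjective _ h3)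
    have := isIso_of_mono_of_epi (Subobject.ofLE _ _ hNU)
    refine hN'U.trans (Subobject.le_of_comm (inv (Subobject.ofLE _ _ hNU)) ?_)
    rw [IsIso.inv_comp_eq, Subobject.ofLE_arrow]
  have htop : N.1 = ⊤ := top_le_iff.1 ((isLUB_fin G M).2 fun N' hN' => hmax N' hN')
  have : IsIso N.1.arrow := (Subobject.isIso_arrow_iff_eq_top _).2 htop
  exact G.fin.prop_of_iso (asIso N.1.arrow) N.2

include F G in
/-- A coalgebra whose category of comodules is an ordered Grothendieck category with finite
dimensional endomorphism rings of simple objects is left semiperfect. -/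
theorem leftSemiperfect_of_isEquivalence [Linear K 𝒞] [IsGrothendieckAbelian.{v} 𝒞]
    (hEnd : ∀ S : 𝒞, Simple S → FiniteDimensional K (S ⟶ S)) : LeftSemiperfect K C := by
  intro J hJ hind
  obtain ⟨E, ⟨e⟩⟩ : ∃ E, Nonempty (F.obj E ≅ J) := ⟨_, ⟨F.objObjPreimageIso J⟩⟩
  have : Injective (F.obj E) := Injective.of_iso e.symm hJ
  have : Injective E := (F.asEquivalence.map_injective_iff E).1 this
  have hEz : ¬ IsZero E := fun h => hind.1 ((F.map_isZero h).of_iso e.symm)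
  have hE : Indecomposable E := by
    refine ⟨hEz, fun Y Z k => ?_⟩
    have h : ∀ A : 𝒞, IsZero (F.obj A) → IsZero A := fun A hA => by
      rw [IsZero.iff_id_eq_zero]
      exact F.map_injective (hA.eq_of_src _ _)
    have := preservesBinaryBiproduct_of_preservesBiproduct F Y Z
    exact (hind.2 _ _ (e.symm ≪≫ F.mapIso k ≪≫ F.mapBiprod Y Z)).imp (h Y) (h Z)
  obtain ⟨S, i, hS, hi⟩ := exists_simple_mono G hEz
  have hess := essentialMono_of_indecomposable hE (Simple.not_isZero S) i
  have : FiniteDimensional K (F.obj E) :=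
    (fin_iff_finiteDimensional F G E).1 (fin_of_essentialMono G hess (hEnd S hS))
  exact Module.Finite.of_surjective _ (bijective_of_isIso e.hom).2

end OrderedGrothendieck

end

theorem mainTheorem8 {K : Type v} [Field K] {𝒞 : Type u} [Category.{v} 𝒞] [Abelian 𝒞]
    [Linear K 𝒞] [IsGrothendieckAbelian.{v} 𝒞] {I : Type w} [PartialOrder I]
    (G : OrderedGrothendieckStructure 𝒞 I)
    (hEnd : ∀ S : 𝒞, Simple S → FiniteDimensional K (S ⟶ S)) :
    (∃ (C : Type v) (_ : AddCommGroup C) (_ : Module K C) (_ : Coalgebra K C)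
      (e : 𝒞 ≌ ComodCat.{v} K C), e.functor.Additive ∧ e.functor.Linear K) ∧
    (∀ (C : Type v) [AddCommGroup C] [Module K C] [Coalgebra K C]
      (e : 𝒞 ≌ ComodCat.{v} K C), e.functor.Additive → e.functor.Linear K →
        LeftSemiperfect K C ∧
        ∀ M : 𝒞, G.fin M ↔ FiniteDimensional K (e.functor.obj M)) := by
  refine ⟨?_, fun C _ _ _ e _ _ =>
    ⟨OrderedGrothendieck.leftSemiperfect_of_isEquivalence e.functor G hEnd,
      OrderedGrothendieck.fin_iff_finiteDimensional e.functor G⟩⟩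
  obtain ⟨E, _, hE, hcog⟩ := OrderedGrothendieck.exists_injective_cogenerator G hEnd
  exact exists_coalgebra_equivalence (OrderedGrothendieck.isLUB_fin G) hE hcog
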